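/- **Setting.** Let $d\in\{2,3\}$ and let $\Omega\subset\mathbb R^d$ be a bounded, simply connected polyhedral domain with Lipschitz boundary and diameter $\rho_\Omega$. Let $\Gamma_D,\Gamma_N\subset\partial\Omega$ be disjoint and measurable, with $\partial\Omega=\overline{\Gamma_D\cup\Gamma_N}$, $|\partial\Omega\setminus(\Gamma_D\cup\Gamma_N)|=0$ and $|\Gamma_D|>0$. Let $\mathcal T_h$ be a finite partition of $\Omega$ into open convex polytopes without hanging nodes (the closures of two different elements meet in a, possibly empty, common face). Let $\mu,\lambda>0$ be the Lamé coefficients, $\varepsilon(v)=(\nabla v+\nabla v^t)/2$, and let $\mathbb S$ be the space of symmetric $d\times d$ matrices. $H^{-1/2}(\partial K,\mathbb R^d)$ is the dual of the trace space $H^{1/2}(\partial K,\mathbb R^d)$ of $H^1(K,\mathbb R^d)$, and boundary integrals denote this duality. Put - $\mathcal X=\{v\in L^2(\Omega,\mathbb R^d): v|_K\in H^1(K,\mathbb R^d)\ \forall K\in\mathcal T_h\}$, with $\|v\|_{\mathcal X}^2=\sum_{K}\big(\rho_\Omega^{-2}\|v\|_{0,K}^2+\|\varepsilon(v)\|_{0,K}^2\big)$;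 - $H_{0,\Gamma_N}(\mathrm{div},\Omega,\mathbb S)$, the space of $\tau\in L^2(\Omega,\mathbb S)$ with $\mathrm{div}\,\tau\in L^2$ (row-wise) and $\int_{\partial\Omega}(\tau n)\cdot v\,ds=0$ for all $v\in H^1(\Omega,\mathbb R^d)$ with vanishing trace on $\partial\Omega\setminus\Gamma_N$; - $\mathcal M$, the space of all $l\in\prod_K H^{-1/2}(\partial K,\mathbb R^d)$ for which the set $T(l)=\{\tau\in H_{0,\Gamma_N}(\mathrm{div},\Omega,\mathbb S):\tau n^{\partial K}=l|_{\partial K}\ \forall K\}$ is nonempty, with $\|l\|_{\mathcal M}=\inf_{\tau\in T(l)}\big[\sum_K(\|\tau\|_{0,K}^2+\rho_\Omega^2\|\mathrm{div}\,\tau\|_{0,K}^2)\big]^{1/2}$; - $\mathcal P=L^2(\Omega)$, or its subspace of functions with zero mean if $\Gamma_D=\partial\Omega$ (up to a set of surface measure zero); $\mathcal H=\mathcal X\times\mathcal P$ with $\|(v,q)\|_{\mathcal H}=\|v\|_{\mathcal X}+\|q\|_{0,\Omega}$; - $a(u,v)=\sum_K\int_K2\mu\,\varepsilon(u):\varepsilon(v)$,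 $b(v,l)=-\sum_K\int_{\partial K}l\cdot v\,ds$, $c(v,q)=\sum_K\int_K q\,\mathrm{div}\,v$; - $\mathfrak a((u,p),(v,q))=a(u,v)+c(v,p)-c(u,q)+\frac1\lambda(p,q)_\Omega$ and $\mathfrak b((v,q),l)=b(v,l)$. The data are $f\in L^2(\Omega,\mathbb R^d)$, a traction $t_N\in\prod_K H^{-1/2}(\partial K,\mathbb R^d)$ supported in $\Gamma_N$ (for each $K$, $\int_{\partial K}t_N\cdot v\,ds=0$ for all $v\in H^1(K,\mathbb R^d)$ with vanishing trace on $\partial K\cap\Gamma_N$), and a displacement $u_D$ on $\Gamma_D$ that is the trace of a function $g\in H^1(\Omega,\mathbb R^d)$. Write $\langle t_N,v\rangle_{\Gamma_N}=\sum_K\int_{\partial K}t_N\cdot v\,ds$ for $v\in\mathcal X$ and $\langle l,u_D\rangle_{\Gamma_D}=\sum_K\int_{\partial K}l\cdot g\,ds$ for $l\in\mathcal M$. Given finite-dimensional subspaces $\mathcal X_h\subset\mathcal X$, $\mathcal P_h\subset\mathcal P$, $\mathcal M_h\subset\mathcal M$ and $\mathcal H_h=\mathcal X_h\times\mathcal P_h$,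 the *discrete HDP problem* is to find $((u_h,p_h),m_h)\in\mathcal H_h\times\mathcal M_h$ with $$\mathfrak a((u_h,p_h),(v,q))+\mathfrak b((v,q),m_h)=-(f,v)_\Omega+\langle t_N,v\rangle_{\Gamma_N}\quad\forall (v,q)\in\mathcal H_h,$$ $$\mathfrak b((u_h,p_h),l)=-\langle l,u_D\rangle_{\Gamma_D}\quad\forall l\in\mathcal M_h,$$ or, in three-field form, $$a(u_h,v)+b(v,m_h)+c(v,p_h)=-(f,v)_\Omega+\langle t_N,v\rangle_{\Gamma_N}\quad\forall v\in\mathcal X_h,$$ $$b(u_h,l)=-\langle l,u_D\rangle_{\Gamma_D}\quad\forall l\in\mathcal M_h,\qquad c(u_h,q)-\tfrac1\lambda(p_h,q)_\Omega=0\quad\forall q\in\mathcal P_h.$$ An *exact solution* is a triple $(u,m,p)\in\mathcal X\times\mathcal M\times\mathcal P$ that solves the three-field form with $\mathcal X,\mathcal M,\mathcal P$ in place of $\mathcal X_h,\mathcal M_h,\mathcal P_h$. **Theorem.** The forms $\mathfrak a$ and $\mathfrak b$ are continuous, the two forms of the discrete HDP problem are equivalent, and the kernel $\mathcal N_h^{\rm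 hdp}=\{x\in\mathcal H_h:\mathfrak b(x,l)=0\ \forall l\in\mathcal M_h\}$ equals $\mathcal N_h^b\times\mathcal P_h$, where $\mathcal N_h^b=\{v\in\mathcal X_h:b(v,l)=0\ \forall l\in\mathcal M_h\}$. Suppose that there are constants $\alpha,\beta>0$ with (B1) $\displaystyle\sup_{y\in\mathcal N_h^{\rm hdp}}\frac{\mathfrak a(x,y)}{\|y\|_{\mathcal H}}\ge\alpha\|x\|_{\mathcal H}$ for all $x\in\mathcal N_h^{\rm hdp}$, (B2) $\displaystyle\sup_{y\in\mathcal H_h}\frac{\mathfrak b(y,l)}{\|y\|_{\mathcal H}}\ge\beta\|l\|_{\mathcal M}$ for all $l\in\mathcal M_h$, where suprema are over nonzero elements (and are $0$ if there are none). Then the discrete HDP problem, in either form, has a unique solution $((u_h,p_h),m_h)\in\mathcal H_h\times\mathcal M_h$. Moreover, for every exact solution $(u,m,p)$, $$\|(u,p)-(u_h,p_h)\|_{\mathcal H}\le C_1\inf_{(v,q)\in\mathcal H_h}\|(u,p)-(v,q)\|_{\mathcal H}+C_2\inf_{l\in\mathcal M_h}\|m-l\|_{\mathcal M},$$ $$\|m-m_h\|_{\mathcal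 M}\le C_3\inf_{(v,q)\in\mathcal H_h}\|(u,p)-(v,q)\|_{\mathcal H}+C_4\inf_{l\in\mathcal M_h}\|m-l\|_{\mathcal M},$$ where $C_1,\dots,C_4$ depend only on $\alpha$, $\beta$ and on continuity constants $C_{\mathfrak a}$, $C_{\mathfrak b}$ of the forms: $|\mathfrak a(x,y)|\le C_{\mathfrak a}\|x\|_{\mathcal H}\|y\|_{\mathcal H}$ on $\mathcal H\times\mathcal H$ and $|\mathfrak b(y,l)|\le C_{\mathfrak b}\|y\|_{\mathcal H}\|l\|_{\mathcal M}$ on $\mathcal H\times\mathcal M$. -/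

import Mathlib

open MeasureTheory Set Filter Topology
open scoped ContDiff ENNReal

noncomputable section

namespace HDP

/-! ### Fields of square-integrable functions and weak derivatives -/

/-- `ℝ^d` with its Euclidean norm. -/
abbrev Vec (d : ℕ) := EuclideanSpace ℝ (Fin d)

/-- Second-order tensors `ℝ^{d × d}`, with the Frobenius inner product. The entry in row `i` and
column `j` of `τ` is `τ (i, j)`. -/
abbrev Tens (d : ℕ) := EuclideanSpace ℝ (Fin d × Fin d)

/-- `L²(D, F)`. -/
abbrev L2 {d : ℕ} (D : Set (Vec d)) (F : Type) [NormedAddCommGroup F] : Type :=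
  Lp F 2 (volume.restrict D)

/-- `C_c^∞(D)`, as functions on the whole space. -/
structure IsTestFunction {d : ℕ} (D : Set (Vec d)) (φ : Vec d → ℝ) : Prop where
  smooth : ContDiff ℝ ∞ φ
  compact : HasCompactSupport φ
  support : tsupport φ ⊆ D

/-- The partial derivative `∂_j φ`. -/
def pd {d : ℕ} (φ : Vec d → ℝ) (j : Fin d) (x : Vec d) : ℝ :=
  fderiv ℝ φ x (EuclideanSpace.single j 1)

/-- On `D`, the tensor field `G` is the weak gradient of the vector field `v`:
`G_ij = ∂_j v_i` in the sense of distributions. -/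
def IsWeakGradient {d : ℕ} (D : Set (Vec d)) (v : Vec d → Vec d) (G : Vec d → Tens d) : Prop :=
  ∀ φ : Vec d → ℝ, IsTestFunction D φ → ∀ i j : Fin d,
    ∫ x in D, v x i * pd φ j x = -∫ x in D, G x (i, j) * φ x

/-- On `D`, the vector field `δ` is the weak row-wise divergence of the tensor field `τ`. -/
def IsWeakDivergence {d : ℕ} (D : Set (Vec d)) (τ : Vec d → Tens d) (δ : Vec d → Vec d) : Prop :=
  ∀ φ : Vec d → ℝ, IsTestFunction D φ → ∀ i : Fin d,
    ∫ x in D, ∑ j, τ x (i, j) * pd φ j x = -∫ x in D, δ x i * φ x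

section Lemmas

variable {d : ℕ} {D D' : Set (Vec d)}

theorem IsTestFunction.pd_continuous {φ : Vec d → ℝ} (h : IsTestFunction D φ) (j : Fin d) :
    Continuous (pd φ j) :=
  (h.smooth.continuous_fderiv (by simp)).clm_apply continuous_const

theorem IsTestFunction.memLp {φ : Vec d → ℝ} (h : IsTestFunction D φ) :
    MemLp φ 2 (volume.restrict D) :=
  (h.smooth.continuous.memLp_of_hasCompactSupport h.compact)

theorem IsTestFunction.pd_memLp {φ : Vec d → ℝ} (h : IsTestFunction D φ) (j : Fin d) :
    MemLp (pd φ j) 2 (volume.restrict D) :=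
  (h.pd_continuous j).memLp_of_hasCompactSupport (h.compact.fderiv_apply ℝ _)

theorem integrable_eval_mul {ι : Type} [Fintype ι] {f : Vec d → EuclideanSpace ℝ ι}
    {g : Vec d → ℝ} (hf : MemLp f 2 (volume.restrict D)) (hg : MemLp g 2 (volume.restrict D))
    (i : ι) : Integrable (fun x => f x i * g x) (volume.restrict D) :=
  (hf.eval_piLp i).integrable_mul hg

theorem IsWeakGradient.congr {v v' : Vec d → Vec d} {G G' : Vec d → Tens d}
    (h : IsWeakGradient D v G) (hv : v =ᵐ[volume.restrict D] v')
    (hG : G =ᵐ[volume.restrict D] G') : IsWeakGradient D v' G' := by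
  intro φ hφ i j
  have e1 : ∫ x in D, v' x i * pd φ j x = ∫ x in D, v x i * pd φ j x :=
    integral_congr_ae (hv.mono fun x hx => by simp [hx])
  have e2 : ∫ x in D, G' x (i, j) * φ x = ∫ x in D, G x (i, j) * φ x :=
    integral_congr_ae (hG.mono fun x hx => by simp [hx])
  rw [e1, e2, h φ hφ i j]

theorem IsWeakGradient.add {v w : Vec d → Vec d} {G H : Vec d → Tens d}
    (hv : MemLp v 2 (volume.restrict D)) (hw : MemLp w 2 (volume.restrict D))
    (hG : MemLp G 2 (volume.restrict D)) (hH : MemLp H 2 (volume.restrict D))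
    (h : IsWeakGradient D v G) (h' : IsWeakGradient D w H) :
    IsWeakGradient D (v + w) (G + H) := by
  intro φ hφ i j
  simp only [Pi.add_apply, PiLp.add_apply, add_mul]
  rw [integral_add (integrable_eval_mul hv (hφ.pd_memLp j) i)
      (integrable_eval_mul hw (hφ.pd_memLp j) i),
    integral_add (integrable_eval_mul hG hφ.memLp (i, j))
      (integrable_eval_mul hH hφ.memLp (i, j)), h φ hφ i j, h' φ hφ i j]
  ring

theorem IsWeakGradient.smul {v : Vec d → Vec d} {G : Vec d → Tens d} (c : ℝ)
    (h : IsWeakGradient D v G) : IsWeakGradient D (c • v) (c • G) := by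
  intro φ hφ i j
  simp only [Pi.smul_apply, PiLp.smul_apply, smul_eq_mul, mul_assoc]
  rw [integral_const_mul, integral_const_mul, h φ hφ i j]
  ring

theorem IsWeakGradient.zero : IsWeakGradient D 0 0 := by
  intro φ hφ i j
  simp

theorem setIntegral_mono_of_zero {f : Vec d → ℝ} (hD : MeasurableSet D)
    (h : D' ⊆ D) (hf : ∀ x, x ∉ D' → f x = 0) : ∫ x in D, f x = ∫ x in D', f x :=
  setIntegral_eq_of_subset_of_forall_sdiff_eq_zero hD h fun x hx => hf x hx.2

theorem IsTestFunction.zero_off {φ : Vec d → ℝ} (h : IsTestFunction D φ) {x : Vec d}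
    (hx : x ∉ D) : φ x = 0 :=
  image_eq_zero_of_notMem_tsupport fun hx' => hx (h.support hx')

theorem IsTestFunction.pd_zero_off {φ : Vec d → ℝ} (h : IsTestFunction D φ) {x : Vec d}
    (hx : x ∉ D) (j : Fin d) : pd φ j x = 0 := by
  have : fderiv ℝ φ x = 0 := by
    refine image_eq_zero_of_notMem_tsupport fun hx' => hx (h.support ?_)
    exact tsupport_fderiv_subset ℝ hx'
  simp [pd, this]

theorem IsWeakGradient.mono {v : Vec d → Vec d} {G : Vec d → Tens d} (hD : MeasurableSet D)
    (h : D' ⊆ D) (hv : IsWeakGradient D v G) : IsWeakGradient D' v G := by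
  intro φ hφ i j
  have hφ' : IsTestFunction D φ := ⟨hφ.smooth, hφ.compact, hφ.support.trans h⟩
  have := hv φ hφ' i j
  rwa [setIntegral_mono_of_zero hD h (fun x hx => by simp [hφ.pd_zero_off hx]),
    setIntegral_mono_of_zero hD h (fun x hx => by simp [hφ.zero_off hx])] at this

/-- Weak gradients are unique almost everywhere. -/
theorem IsWeakGradient.unique {v : Vec d → Vec d} {G G' : Vec d → Tens d} (hD : IsOpen D)
    (hG : MemLp G 2 (volume.restrict D)) (hG' : MemLp G' 2 (volume.restrict D))
    (h : IsWeakGradient D v G) (h' : IsWeakGradient D v G') :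
    G =ᵐ[volume.restrict D] G' := by
  have key : ∀ k : Fin d × Fin d, ∀ᵐ x ∂(volume.restrict D), (G - G') x k = 0 := by
    rintro ⟨i, j⟩
    have hmem : MemLp (fun x => (G - G') x (i, j)) 2 (volume.restrict D) :=
      (hG.sub hG').eval_piLp (i, j)
    rw [ae_restrict_iff' hD.measurableSet]
    refine hD.ae_eq_zero_of_integral_contDiff_smul_eq_zero (f := fun x => (G - G') x (i, j))
      ?_ ?_
    · refine (locallyIntegrableOn_iff hD.isLocallyClosed).2 ?_
      intro K hKD hK
      have hfin : IsFiniteMeasure (volume.restrict K) := ⟨by simpa using hK.measure_lt_top⟩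
      have hm : MemLp (fun x => (G - G') x (i, j)) 2 (volume.restrict K) :=
        hmem.mono_measure (Measure.restrict_mono hKD le_rfl)
      exact hm.integrable (by norm_num)
    · intro φ h1 h2 h3
      have hφ : IsTestFunction D φ := ⟨h1, h2, h3⟩
      have e := h φ hφ i j
      rw [h' φ hφ i j] at e
      have e2 : ∫ x in D, (G x (i, j) * φ x - G' x (i, j) * φ x) = 0 := by
        rw [integral_sub (integrable_eval_mul hG hφ.memLp (i, j))
          (integrable_eval_mul hG' hφ.memLp (i, j))]
        linarith
      rw [← e2, ← setIntegral_mono_of_zero (D := univ) (D' := D) MeasurableSet.univ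
        (subset_univ _)]
      · simp only [Measure.restrict_univ]
        refine integral_congr_ae (Eventually.of_forall fun x => ?_)
        simp [mul_comm, mul_sub]
      · intro x hx
        simp [hφ.zero_off hx]
  filter_upwards [ae_all_iff.2 key] with x hx
  ext k
  have := hx k
  simp only [Pi.sub_apply, PiLp.sub_apply] at this
  linarith

end Lemmas

/-! ### Restriction of square-integrable fields -/

theorem memLp_restrict {d : ℕ} {D D' : Set (Vec d)} {F : Type} [NormedAddCommGroup F]
    (h : D' ⊆ D) (f : L2 D F) : MemLp f 2 (volume.restrict D') :=
  (Lp.memLp f).mono_measure (Measure.restrict_mono h le_rfl)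

theorem ae_restrict_of_subset' {d : ℕ} {D D' : Set (Vec d)} (h : D' ⊆ D) {p : Vec d → Prop}
    (hp : ∀ᵐ x ∂(volume.restrict D), p x) : ∀ᵐ x ∂(volume.restrict D'), p x :=
  (Measure.absolutelyContinuous_of_le (Measure.restrict_mono h le_rfl)).ae_le hp

/-- The restriction `L²(D, F) → L²(D', F)` for `D' ⊆ D`. -/
def restrictL2 {d : ℕ} {D D' : Set (Vec d)} {F : Type} [NormedAddCommGroup F] [NormedSpace ℝ F]
    (h : D' ⊆ D) : L2 D F →ₗ[ℝ] L2 D' F where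
  toFun f := (memLp_restrict h f).toLp f
  map_add' f g := by
    rw [← MemLp.toLp_add]
    exact MemLp.toLp_congr _ _ (ae_restrict_of_subset' h (Lp.coeFn_add f g))
  map_smul' c f := by
    rw [RingHom.id_apply, ← MemLp.toLp_const_smul]
    exact MemLp.toLp_congr _ _ (ae_restrict_of_subset' h (Lp.coeFn_smul c f))

theorem restrictL2_ae {d : ℕ} {D D' : Set (Vec d)} {F : Type} [NormedAddCommGroup F]
    [NormedSpace ℝ F] (h : D' ⊆ D) (f : L2 D F) :
    restrictL2 h f =ᵐ[volume.restrict D'] f :=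
  (memLp_restrict h f).coeFn_toLp

/-! ### The space `H¹`, vanishing traces, and the boundary spaces `H^{±1/2}` -/

/-- `H¹(D, ℝ^d)`, a function being stored together with its weak gradient (which it determines when
`D` is open). The topology inherited from `L² × L²` is the one of the usual `H¹` norm. -/
def H1 {d : ℕ} (D : Set (Vec d)) : Submodule ℝ (L2 D (Vec d) × L2 D (Tens d)) where
  carrier := {w | IsWeakGradient D w.1 w.2}
  add_mem' := fun {w z} hw hz =>
    (IsWeakGradient.add (Lp.memLp w.1) (Lp.memLp z.1) (Lp.memLp w.2) (Lp.memLp z.2) hw hz).congr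
      (Lp.coeFn_add w.1 z.1).symm (Lp.coeFn_add w.2 z.2).symm
  zero_mem' := IsWeakGradient.zero.congr (Lp.coeFn_zero _ _ _).symm (Lp.coeFn_zero _ _ _).symm
  smul_mem' := fun c w hw =>
    (IsWeakGradient.smul c hw).congr (Lp.coeFn_smul c w.1).symm (Lp.coeFn_smul c w.2).symm

/-- The classical gradient of a vector field: entry `(i, j)` is `∂_j φ_i`. -/
def gradTens {d : ℕ} (φ : Vec d → Vec d) (x : Vec d) : Tens d :=
  WithLp.toLp 2 fun k => fderiv ℝ φ x (EuclideanSpace.single k.2 1) k.1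

/-- The surface measure on the boundary of a Lipschitz domain (up to a constant factor): the
`(d-1)`-dimensional Hausdorff measure. -/
def surface (d : ℕ) : Measure (Vec d) := Measure.hausdorffMeasure ((d : ℝ) - 1)

/-- `w ∈ H¹(D, ℝ^d)` has vanishing trace on `Γ ⊆ ∂D`: some fields in `C_c^∞(ℝ^d)` converge to `w` in
`H¹(D)` while their restrictions to `Γ` converge to `0` in `L²(Γ)`. On a bounded Lipschitz domain,
where smooth fields are dense in `H¹` and the trace `H¹(D) → L²(∂D)` is continuous, this says that
the trace of `w` is zero almost everywhere on `Γ`. -/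
def HasZeroTrace {d : ℕ} (D Γ : Set (Vec d)) (w : L2 D (Vec d) × L2 D (Tens d)) : Prop :=
  ∃ φ : ℕ → Vec d → Vec d,
    (∀ n, ContDiff ℝ ∞ (φ n) ∧ HasCompactSupport (φ n)) ∧
    Tendsto (fun n => eLpNorm (φ n - ⇑w.1) 2 (volume.restrict D)) atTop (𝓝 0) ∧
    Tendsto (fun n => eLpNorm (gradTens (φ n) - ⇑w.2) 2 (volume.restrict D)) atTop (𝓝 0) ∧
    Tendsto (fun n => eLpNorm (φ n) 2 ((surface d).restrict Γ)) atTop (𝓝 0)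

theorem gradTens_continuous {d : ℕ} {φ : Vec d → Vec d} (h : ContDiff ℝ ∞ φ) :
    Continuous (gradTens φ) := by
  refine (PiLp.continuous_toLp 2 _).comp (continuous_pi fun k => ?_)
  exact (EuclideanSpace.proj (𝕜 := ℝ) k.1).continuous.comp
    ((h.continuous_fderiv (by simp)).clm_apply continuous_const)

theorem gradTens_add {d : ℕ} {φ ψ : Vec d → Vec d} (h : ContDiff ℝ ∞ φ) (h' : ContDiff ℝ ∞ ψ) :
    gradTens (φ + ψ) = gradTens φ + gradTens ψ := by
  funext x
  ext k
  simp only [gradTens, Pi.add_apply, PiLp.add_apply]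
  rw [fderiv_add (h.differentiable (by simp) x) (h'.differentiable (by simp) x)]
  simp

theorem gradTens_smul {d : ℕ} (c : ℝ) {φ : Vec d → Vec d} (h : ContDiff ℝ ∞ φ) :
    gradTens (c • φ) = c • gradTens φ := by
  funext x
  ext k
  simp only [gradTens, Pi.smul_apply, PiLp.smul_apply]
  rw [fderiv_const_smul (h.differentiable (by simp) x)]
  simp

theorem tendsto_eLpNorm_add {d : ℕ} {F : Type} [NormedAddCommGroup F] {m : Measure (Vec d)}
    {f g h : ℕ → Vec d → F} (hf : ∀ n, AEStronglyMeasurable (f n) m)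
    (hg : ∀ n, AEStronglyMeasurable (g n) m) (hh : ∀ n, h n =ᵐ[m] f n + g n)
    (h1 : Tendsto (fun n => eLpNorm (f n) 2 m) atTop (𝓝 0))
    (h2 : Tendsto (fun n => eLpNorm (g n) 2 m) atTop (𝓝 0)) :
    Tendsto (fun n => eLpNorm (h n) 2 m) atTop (𝓝 0) := by
  have h3 : Tendsto (fun n => eLpNorm (f n) 2 m + eLpNorm (g n) 2 m) atTop (𝓝 0) := by
    simpa using h1.add h2
  refine tendsto_of_tendsto_of_tendsto_of_le_of_le tendsto_const_nhds h3 (fun n => zero_le)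
    fun n => ?_
  show eLpNorm (h n) 2 m ≤ _
  rw [eLpNorm_congr_ae (hh n)]
  exact eLpNorm_add_le (hf n) (hg n) (by norm_num)

theorem tendsto_eLpNorm_smul {d : ℕ} {F : Type} [NormedAddCommGroup F] [NormedSpace ℝ F]
    {m : Measure (Vec d)} {f h : ℕ → Vec d → F} (c : ℝ) (hh : ∀ n, h n =ᵐ[m] c • f n)
    (h1 : Tendsto (fun n => eLpNorm (f n) 2 m) atTop (𝓝 0)) :
    Tendsto (fun n => eLpNorm (h n) 2 m) atTop (𝓝 0) := by
  have h3 : Tendsto (fun n => ‖c‖ₑ * eLpNorm (f n) 2 m) atTop (𝓝 0) := by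
    simpa using ENNReal.Tendsto.const_mul h1 (Or.inr (by simp : ‖c‖ₑ ≠ ⊤))
  refine h3.congr fun n => ?_
  rw [eLpNorm_congr_ae (hh n), eLpNorm_const_smul]

theorem HasZeroTrace.add {d : ℕ} {D Γ : Set (Vec d)} {w z : L2 D (Vec d) × L2 D (Tens d)}
    (hw : HasZeroTrace D Γ w) (hz : HasZeroTrace D Γ z) : HasZeroTrace D Γ (w + z) := by
  obtain ⟨φ, a1, a2, a3, a4⟩ := hw
  obtain ⟨ψ, b1, b2, b3, b4⟩ := hz
  refine ⟨fun n => φ n + ψ n, fun n => ⟨(a1 n).1.add (b1 n).1, (a1 n).2.add (b1 n).2⟩, ?_, ?_, ?_⟩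
  · refine tendsto_eLpNorm_add
      (fun n => ((a1 n).1.continuous.aestronglyMeasurable.sub (Lp.aestronglyMeasurable _)))
      (fun n => ((b1 n).1.continuous.aestronglyMeasurable.sub (Lp.aestronglyMeasurable _)))
      (fun n => ?_) a2 b2
    filter_upwards [Lp.coeFn_add w.1 z.1] with x hx
    simp only [Prod.fst_add, Pi.sub_apply, Pi.add_apply, hx]
    abel
  · refine tendsto_eLpNorm_add
      (fun n => ((gradTens_continuous (a1 n).1).aestronglyMeasurable.sub
        (Lp.aestronglyMeasurable _)))
      (fun n => ((gradTens_continuous (b1 n).1).aestronglyMeasurable.sub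
        (Lp.aestronglyMeasurable _)))
      (fun n => ?_) a3 b3
    rw [gradTens_add (a1 n).1 (b1 n).1]
    filter_upwards [Lp.coeFn_add w.2 z.2] with x hx
    simp only [Prod.snd_add, Pi.sub_apply, Pi.add_apply, hx]
    abel
  · exact tendsto_eLpNorm_add (fun n => (a1 n).1.continuous.aestronglyMeasurable)
      (fun n => (b1 n).1.continuous.aestronglyMeasurable) (fun n => EventuallyEq.rfl) a4 b4

theorem HasZeroTrace.smul {d : ℕ} {D Γ : Set (Vec d)} {w : L2 D (Vec d) × L2 D (Tens d)} (c : ℝ)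
    (hw : HasZeroTrace D Γ w) : HasZeroTrace D Γ (c • w) := by
  obtain ⟨φ, a1, a2, a3, a4⟩ := hw
  refine ⟨fun n => c • φ n,
    fun n => ⟨contDiff_const.smul (a1 n).1, (a1 n).2.smul_left (f := fun _ => c)⟩, ?_, ?_, ?_⟩
  · refine tendsto_eLpNorm_smul c (fun n => ?_) a2
    filter_upwards [Lp.coeFn_smul c w.1] with x hx
    simp only [Prod.smul_fst, Pi.sub_apply, Pi.smul_apply, hx, smul_sub]
  · refine tendsto_eLpNorm_smul c (fun n => ?_) a3
    rw [gradTens_smul c (a1 n).1]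
    filter_upwards [Lp.coeFn_smul c w.2] with x hx
    simp only [Prod.smul_snd, Pi.sub_apply, Pi.smul_apply, hx, smul_sub]
  · exact tendsto_eLpNorm_smul c (fun n => EventuallyEq.rfl) a4

theorem HasZeroTrace.zero {d : ℕ} {D Γ : Set (Vec d)} :
    HasZeroTrace D Γ (0 : L2 D (Vec d) × L2 D (Tens d)) := by
  have e1 : (0 : Vec d → Vec d) - ⇑(0 : L2 D (Vec d)) =ᵐ[volume.restrict D] 0 := by
    filter_upwards [Lp.coeFn_zero (Vec d) 2 (volume.restrict D)] with x hx
    rw [Pi.sub_apply, hx]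
    simp
  have e2 : gradTens (0 : Vec d → Vec d) - ⇑(0 : L2 D (Tens d)) =ᵐ[volume.restrict D] 0 := by
    filter_upwards [Lp.coeFn_zero (Tens d) 2 (volume.restrict D)] with x hx
    rw [Pi.sub_apply, hx]
    ext k
    simp [gradTens]
  refine ⟨fun _ => 0, fun n => ⟨contDiff_const, HasCompactSupport.zero⟩, ?_, ?_, ?_⟩
  · simp only [Prod.fst_zero, eLpNorm_congr_ae e1, eLpNorm_zero]
    exact tendsto_const_nhds
  · simp only [Prod.snd_zero, eLpNorm_congr_ae e2, eLpNorm_zero]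
    exact tendsto_const_nhds
  · simp only [eLpNorm_zero]
    exact tendsto_const_nhds

/-- `H¹_{0,Γ}(D, ℝ^d)`: the functions in `H¹(D, ℝ^d)` with vanishing trace on `Γ`. -/
def H1Zero {d : ℕ} (D Γ : Set (Vec d)) : Submodule ℝ (H1 D) where
  carrier := {w | HasZeroTrace D Γ w.1}
  add_mem' := fun hw hz => hw.add hz
  zero_mem' := HasZeroTrace.zero
  smul_mem' := fun c _ hw => hw.smul c

/-- `H^{1/2}(∂D, ℝ^d)`, the space of traces on `∂D` of the functions in `H¹(D, ℝ^d)`: functions in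
`H¹` modulo those with vanishing trace. -/
def HHalf {d : ℕ} (D : Set (Vec d)) : Type := H1 D ⧸ H1Zero D (frontier D)

instance {d : ℕ} (D : Set (Vec d)) : SeminormedAddCommGroup (HHalf D) :=
  inferInstanceAs (SeminormedAddCommGroup (H1 D ⧸ H1Zero D (frontier D)))

instance {d : ℕ} (D : Set (Vec d)) : NormedSpace ℝ (HHalf D) :=
  inferInstanceAs (NormedSpace ℝ (H1 D ⧸ H1Zero D (frontier D)))

/-- The trace `H¹(D, ℝ^d) → H^{1/2}(∂D, ℝ^d)`. -/
def trace {d : ℕ} {D : Set (Vec d)} : H1 D →ₗ[ℝ] HHalf D := (H1Zero D (frontier D)).mkQ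

/-- `H^{-1/2}(∂D, ℝ^d)`, the topological dual of `H^{1/2}(∂D, ℝ^d)`. -/
def HMinusHalf {d : ℕ} (D : Set (Vec d)) : Type := StrongDual ℝ (HHalf D)

instance {d : ℕ} (D : Set (Vec d)) : AddCommGroup (HMinusHalf D) :=
  inferInstanceAs (AddCommGroup (StrongDual ℝ (HHalf D)))

instance {d : ℕ} (D : Set (Vec d)) : Module ℝ (HMinusHalf D) :=
  inferInstanceAs (Module ℝ (StrongDual ℝ (HHalf D)))

/-- The boundary integral `∫_{∂D} l · v ds`: the value of `l` at the trace of `v`. -/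
def HMinusHalf.integral {d : ℕ} {D : Set (Vec d)} (l : HMinusHalf D) (v : H1 D) : ℝ :=
  (show StrongDual ℝ (HHalf D) from l) (trace v)

/-! ### The domain, the boundary parts, and the mesh -/

/-- The boundary of `D` is Lipschitz: near each boundary point, `D` is the part of space above the
graph of a Lipschitz function `g`, in a suitable direction `e`. Only the values of `g` on the
hyperplane orthogonal to `e` are used. -/
def HasLipschitzBoundary {d : ℕ} (D : Set (Vec d)) : Prop :=
  ∀ x ∈ frontier D, ∃ (e : Vec d) (r : ℝ) (g : Vec d → ℝ) (L : NNReal),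
    ‖e‖ = 1 ∧ 0 < r ∧ LipschitzWith L g ∧
      ∀ y ∈ Metric.ball x r, (y ∈ D ↔ g (y - (inner ℝ y e) • e) < inner ℝ y e)

/-- A simply connected bounded polyhedral domain with Lipschitz boundary. -/
structure PolyhedralDomain (d : ℕ) where
  carrier : Set (Vec d)
  isOpen : IsOpen carrier
  bounded : Bornology.IsBounded carrier
  connected : IsConnected carrier
  simplyConnected : SimplyConnectedSpace carrier
  polyhedral : ∃ 𝒮 : Finset (Finset (Vec d)),
    closure carrier = ⋃ s ∈ 𝒮, convexHull ℝ (s : Set (Vec d))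
  lipschitz : HasLipschitzBoundary carrier

/-- A partition of `∂Ω` into the parts `Γ_D` (of positive measure) and `Γ_N`; the interface between
the two parts is negligible. -/
structure BoundaryPartition {d : ℕ} (Ω : PolyhedralDomain d) where
  ΓD : Set (Vec d)
  ΓN : Set (Vec d)
  measurable_D : MeasurableSet ΓD
  measurable_N : MeasurableSet ΓN
  disjoint : Disjoint ΓD ΓN
  cover : frontier Ω.carrier = closure (ΓD ∪ ΓN)
  interface : surface d (frontier Ω.carrier \ (ΓD ∪ ΓN)) = 0
  pos : 0 < surface d ΓD

/-- A partition of `Ω` into finitely many nonempty open convex polytopes without hanging nodes: the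
closures of two different elements meet in a (possibly empty) common face. -/
structure Mesh {d : ℕ} (Ω : PolyhedralDomain d) where
  cells : Finset (Set (Vec d))
  polytope : ∀ K ∈ cells, K.Nonempty ∧
    ∃ s : Finset (Vec d), K = interior (convexHull ℝ (s : Set (Vec d)))
  subset : ∀ K ∈ cells, K ⊆ Ω.carrier
  disjoint : ∀ K ∈ cells, ∀ K' ∈ cells, K ≠ K' → Disjoint K K'
  cover : closure Ω.carrier = ⋃ K ∈ cells, closure K
  conforming : ∀ K ∈ cells, ∀ K' ∈ cells, K ≠ K' →
    IsExposed ℝ (closure K) (closure K ∩ closure K')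

/-- The diameter `ρ_Ω`. -/
def PolyhedralDomain.diam {d : ℕ} (Ω : PolyhedralDomain d) : ℝ := Metric.diam Ω.carrier

/-- The elements of the mesh, as an index type. -/
abbrev Mesh.Cell {d : ℕ} {Ω : PolyhedralDomain d} (T : Mesh Ω) : Type := {K // K ∈ T.cells}

/-! ### The broken space `X` -/

/-- `X = {v ∈ L²(Ω, ℝ^d) : v|_K ∈ H¹(K, ℝ^d) for every element K}`, a function being stored together
with its element-wise weak gradient (which it determines). -/
def X {d : ℕ} {Ω : PolyhedralDomain d} (T : Mesh Ω) :
    Submodule ℝ (L2 Ω.carrier (Vec d) × L2 Ω.carrier (Tens d)) where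
  carrier := {w | ∀ K ∈ T.cells, IsWeakGradient K w.1 w.2}
  add_mem' := fun {w z} hw hz K hK =>
    have h := T.subset K hK
    (IsWeakGradient.add (memLp_restrict h w.1) (memLp_restrict h z.1) (memLp_restrict h w.2)
      (memLp_restrict h z.2) (hw K hK) (hz K hK)).congr
      (ae_restrict_of_subset' h (Lp.coeFn_add w.1 z.1).symm)
      (ae_restrict_of_subset' h (Lp.coeFn_add w.2 z.2).symm)
  zero_mem' := fun K hK =>
    have h := T.subset K hK
    IsWeakGradient.zero.congr (ae_restrict_of_subset' h (Lp.coeFn_zero _ _ _).symm)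
      (ae_restrict_of_subset' h (Lp.coeFn_zero _ _ _).symm)
  smul_mem' := fun c w hw K hK =>
    have h := T.subset K hK
    (IsWeakGradient.smul c (hw K hK)).congr
      (ae_restrict_of_subset' h (Lp.coeFn_smul c w.1).symm)
      (ae_restrict_of_subset' h (Lp.coeFn_smul c w.2).symm)

section Forms

variable {d : ℕ} {Ω : PolyhedralDomain d} {T : Mesh Ω}

/-- The field underlying an element of `X`. -/
def X.val (v : X T) : Vec d → Vec d := v.1.1

/-- The element-wise gradient. -/
def X.grad (v : X T) : Vec d → Tens d := v.1.2

/-- The element-wise infinitesimal strain `ε(v) = (∇v + (∇v)ᵗ)/2`. -/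
def X.strain (v : X T) (x : Vec d) : Tens d :=
  WithLp.toLp 2 fun k => (X.grad v x (k.1, k.2) + X.grad v x (k.2, k.1)) / 2

/-- The element-wise divergence. -/
def X.div (v : X T) (x : Vec d) : ℝ := ∑ i, X.grad v x (i, i)

/-- The restriction `v|_K ∈ H¹(K, ℝ^d)` of `v ∈ X`. -/
def X.toCell (K : T.Cell) : X T →ₗ[ℝ] H1 (K : Set (Vec d)) where
  toFun v := ⟨(restrictL2 (T.subset K K.2) v.1.1, restrictL2 (T.subset K K.2) v.1.2),
    (v.2 K K.2).congr (restrictL2_ae (T.subset K K.2) v.1.1).symm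
      (restrictL2_ae (T.subset K K.2) v.1.2).symm⟩
  map_add' v w := by
    ext1
    simp
  map_smul' c v := by
    ext1
    simp

/-- The inclusion `H¹(Ω, ℝ^d) ⊆ X`. -/
def H1.toX (T : Mesh Ω) (g : H1 Ω.carrier) : X T :=
  ⟨g.1, fun K hK => IsWeakGradient.mono Ω.isOpen.measurableSet (T.subset K hK) g.2⟩

/-! ### The multiplier space `M` -/

/-- `H(div, Ω, 𝕊)`: symmetric square-integrable tensor fields with square-integrable divergence, a
field being stored together with its weak divergence (which it determines). -/
def IsHdivSym (Ω : PolyhedralDomain d)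
    (τ : L2 Ω.carrier (Tens d) × L2 Ω.carrier (Vec d)) : Prop :=
  IsWeakDivergence Ω.carrier τ.1 τ.2 ∧
    ∀ᵐ x ∂(volume.restrict Ω.carrier), ∀ i j, τ.1 x (i, j) = τ.1 x (j, i)

/-- `∫_D div τ · v + τ : ∇v dx`; by Green's formula, this is the boundary integral of `(τ n) · v`
over `∂D`. -/
def green (D : Set (Vec d)) (τ : L2 Ω.carrier (Tens d) × L2 Ω.carrier (Vec d))
    (w : L2 D (Vec d) × L2 D (Tens d)) : ℝ :=
  ∫ x in D, (inner ℝ (τ.2 x) (w.1 x) + inner ℝ (τ.1 x) (w.2 x))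

theorem green_eq {K : Set (Vec d)} (h : K ⊆ Ω.carrier)
    (τ : L2 Ω.carrier (Tens d) × L2 Ω.carrier (Vec d)) (w : L2 K (Vec d) × L2 K (Tens d)) :
    green K τ w = inner ℝ (restrictL2 h τ.2) w.1 + inner ℝ (restrictL2 h τ.1) w.2 := by
  rw [L2.inner_def, L2.inner_def, ← integral_add (L2.integrable_inner _ _)
    (L2.integrable_inner _ _)]
  refine integral_congr_ae ?_
  filter_upwards [restrictL2_ae h τ.1, restrictL2_ae h τ.2] with x h1 h2
  rw [h1, h2]

theorem green_add {K : Set (Vec d)} (h : K ⊆ Ω.carrier)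
    (τ σ : L2 Ω.carrier (Tens d) × L2 Ω.carrier (Vec d)) (w : L2 K (Vec d) × L2 K (Tens d)) :
    green K (τ + σ) w = green K τ w + green K σ w := by
  simp only [green_eq h, Prod.fst_add, Prod.snd_add, map_add, inner_add_left]
  ring

theorem green_smul {K : Set (Vec d)} (h : K ⊆ Ω.carrier) (c : ℝ)
    (τ : L2 Ω.carrier (Tens d) × L2 Ω.carrier (Vec d)) (w : L2 K (Vec d) × L2 K (Tens d)) :
    green K (c • τ) w = c * green K τ w := by
  simp only [green_eq h, Prod.smul_fst, Prod.smul_snd, map_smul, real_inner_smul_left]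
  ring

theorem IsHdivSym.add {τ σ : L2 Ω.carrier (Tens d) × L2 Ω.carrier (Vec d)}
    (h : IsHdivSym Ω τ) (h' : IsHdivSym Ω σ) : IsHdivSym Ω (τ + σ) := by
  refine ⟨fun φ hφ i => ?_, ?_⟩
  · have I1 : ∀ f : L2 Ω.carrier (Tens d), Integrable (fun x => ∑ j, f x (i, j) * pd φ j x)
        (volume.restrict Ω.carrier) := fun f =>
      integrable_finsetSum _ fun j _ =>
        integrable_eval_mul (Lp.memLp f) (hφ.pd_memLp j) (i, j)
    have I2 : ∀ f : L2 Ω.carrier (Vec d), Integrable (fun x => f x i * φ x)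
        (volume.restrict Ω.carrier) := fun f => integrable_eval_mul (Lp.memLp f) hφ.memLp i
    have e1 : ∫ x in Ω.carrier, ∑ j, (τ + σ).1 x (i, j) * pd φ j x =
        ∫ x in Ω.carrier, ((∑ j, τ.1 x (i, j) * pd φ j x) + ∑ j, σ.1 x (i, j) * pd φ j x) := by
      refine integral_congr_ae ?_
      filter_upwards [Lp.coeFn_add τ.1 σ.1] with x hx
      simp only [Prod.fst_add, hx, Pi.add_apply, PiLp.add_apply, add_mul,
        Finset.sum_add_distrib]
    have e2 : ∫ x in Ω.carrier, (τ + σ).2 x i * φ x =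
        ∫ x in Ω.carrier, (τ.2 x i * φ x + σ.2 x i * φ x) := by
      refine integral_congr_ae ?_
      filter_upwards [Lp.coeFn_add τ.2 σ.2] with x hx
      simp only [Prod.snd_add, hx, Pi.add_apply, PiLp.add_apply, add_mul]
    rw [e1, e2, integral_add (I1 _) (I1 _), integral_add (I2 _) (I2 _), h.1 φ hφ i, h'.1 φ hφ i]
    ring
  · filter_upwards [h.2, h'.2, Lp.coeFn_add τ.1 σ.1] with x h1 h2 hx i j
    simp only [Prod.fst_add, hx, Pi.add_apply, PiLp.add_apply, h1 i j, h2 i j]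

theorem IsHdivSym.smul (c : ℝ) {τ : L2 Ω.carrier (Tens d) × L2 Ω.carrier (Vec d)}
    (h : IsHdivSym Ω τ) : IsHdivSym Ω (c • τ) := by
  refine ⟨fun φ hφ i => ?_, ?_⟩
  · have e1 : ∫ x in Ω.carrier, ∑ j, (c • τ).1 x (i, j) * pd φ j x =
        ∫ x in Ω.carrier, c * ∑ j, τ.1 x (i, j) * pd φ j x := by
      refine integral_congr_ae ?_
      filter_upwards [Lp.coeFn_smul c τ.1] with x hx
      simp [hx, mul_assoc, Finset.mul_sum]
    have e2 : ∫ x in Ω.carrier, (c • τ).2 x i * φ x =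
        ∫ x in Ω.carrier, c * (τ.2 x i * φ x) := by
      refine integral_congr_ae ?_
      filter_upwards [Lp.coeFn_smul c τ.2] with x hx
      simp [hx, mul_assoc]
    rw [e1, e2, integral_const_mul, integral_const_mul, h.1 φ hφ i]
    ring
  · filter_upwards [h.2, Lp.coeFn_smul c τ.1] with x h1 hx i j
    simp [hx, h1 i j]

theorem IsHdivSym.zero : IsHdivSym Ω 0 := by
  refine ⟨fun φ hφ i => ?_, ?_⟩
  · have e1 : ∫ x in Ω.carrier,
        ∑ j, (0 : L2 Ω.carrier (Tens d) × L2 Ω.carrier (Vec d)).1 x (i, j) * pd φ j x = 0 := by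
      rw [← integral_zero (Vec d) ℝ]
      refine integral_congr_ae ?_
      filter_upwards [Lp.coeFn_zero (Tens d) 2 (volume.restrict Ω.carrier)] with x hx
      simp only [Prod.fst_zero, hx]
      simp
    have e2 : ∫ x in Ω.carrier,
        (0 : L2 Ω.carrier (Tens d) × L2 Ω.carrier (Vec d)).2 x i * φ x = 0 := by
      rw [← integral_zero (Vec d) ℝ]
      refine integral_congr_ae ?_
      filter_upwards [Lp.coeFn_zero (Vec d) 2 (volume.restrict Ω.carrier)] with x hx
      simp only [Prod.snd_zero, hx]
      simp
    rw [e1, e2, neg_zero]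
  · filter_upwards [Lp.coeFn_zero (Tens d) 2 (volume.restrict Ω.carrier)] with x hx i j
    simp only [Prod.fst_zero, hx]
    simp

theorem green_zero {K : Set (Vec d)} (h : K ⊆ Ω.carrier) (w : L2 K (Vec d) × L2 K (Tens d)) :
    green (Ω := Ω) K 0 w = 0 := by
  simp [green_eq h]

/-- `H_{0,Γ_N}(div, Ω, 𝕊)`: the fields `τ` in `H(div, Ω, 𝕊)` with `∫_{∂Ω} (τ n) · v ds = 0` for all
`v ∈ H¹_{0,∂Ω∖Γ_N}(Ω, ℝ^d)`. -/
def HdivZero (Γ : BoundaryPartition Ω) :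
    Submodule ℝ (L2 Ω.carrier (Tens d) × L2 Ω.carrier (Vec d)) where
  carrier := {τ | IsHdivSym Ω τ ∧
    ∀ v ∈ H1Zero Ω.carrier (frontier Ω.carrier \ Γ.ΓN), green Ω.carrier τ v.1 = 0}
  add_mem' := fun hτ hσ => ⟨hτ.1.add hσ.1, fun v hv => by
    rw [green_add subset_rfl, hτ.2 v hv, hσ.2 v hv, add_zero]⟩
  zero_mem' := ⟨IsHdivSym.zero, fun v _ => green_zero subset_rfl v.1⟩
  smul_mem' := fun c _ hτ => ⟨hτ.1.smul c, fun v hv => by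
    rw [green_smul subset_rfl, hτ.2 v hv, mul_zero]⟩

/-- `τ n^{∂K} = l` over `∂K`, as elements of `H^{-1/2}(∂K, ℝ^d)`. -/
def IsNormalTrace (K : Set (Vec d)) (τ : L2 Ω.carrier (Tens d) × L2 Ω.carrier (Vec d))
    (l : HMinusHalf K) : Prop :=
  ∀ v : H1 K, l.integral v = green K τ v.1

/-- The multiplier space `M`: families `l` in `∏_K H^{-1/2}(∂K, ℝ^d)` such that some
`τ ∈ H_{0,Γ_N}(div, Ω, 𝕊)` satisfies `τ n^{∂K} = l` over `∂K` for every element `K`. -/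
def M (Γ : BoundaryPartition Ω) (T : Mesh Ω) :
    Submodule ℝ ((K : T.Cell) → HMinusHalf (K : Set (Vec d))) where
  carrier := {l | ∃ τ ∈ HdivZero Γ, ∀ K : T.Cell, IsNormalTrace (K : Set (Vec d)) τ (l K)}
  add_mem' := by
    rintro l l' ⟨τ, hτ, h⟩ ⟨σ, hσ, h'⟩
    refine ⟨τ + σ, add_mem hτ hσ, fun K v => ?_⟩
    rw [green_add (T.subset K K.2), ← h K v, ← h' K v]
    rfl
  zero_mem' := ⟨0, zero_mem _, fun K v => by
    rw [green_zero (T.subset K K.2)]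
    rfl⟩
  smul_mem' := by
    rintro c l ⟨τ, hτ, h⟩
    refine ⟨c • τ, Submodule.smul_mem _ c hτ, fun K v => ?_⟩
    rw [green_smul (T.subset K K.2), ← h K v]
    rfl

/-- The set `T(l)` of the fields `τ ∈ H_{0,Γ_N}(div, Ω, 𝕊)` with `τ n^{∂K} = l` over `∂K` for every
element `K`. -/
def liftings (Γ : BoundaryPartition Ω) (T : Mesh Ω) (l : M Γ T) :
    Set (L2 Ω.carrier (Tens d) × L2 Ω.carrier (Vec d)) :=
  {τ | τ ∈ HdivZero Γ ∧ ∀ K : T.Cell, IsNormalTrace (K : Set (Vec d)) τ (l.1 K)}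

/-! ### The pressure space `P` -/

instance (Ω : PolyhedralDomain d) : IsFiniteMeasure ((volume : Measure (Vec d)).restrict Ω.carrier) :=
  ⟨by simpa using Ω.bounded.measure_lt_top⟩

/-- `P`: all of `L²(Ω)`, or its subspace of functions with zero mean in the pure Dirichlet case
`Γ_D = ∂Ω` (up to a set of surface measure zero). -/
def P (Γ : BoundaryPartition Ω) : Submodule ℝ (L2 Ω.carrier ℝ) where
  carrier := {q | surface d (frontier Ω.carrier \ Γ.ΓD) = 0 → ∫ x in Ω.carrier, q x = 0}
  add_mem' := fun {p q} hp hq h => by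
    rw [integral_congr_ae (Lp.coeFn_add p q)]
    simp only [Pi.add_apply]
    rw [integral_add ((Lp.memLp p).integrable (by norm_num))
      ((Lp.memLp q).integrable (by norm_num)), hp h, hq h, add_zero]
  zero_mem' := fun _ => by
    rw [integral_congr_ae (Lp.coeFn_zero _ _ _)]
    simp
  smul_mem' := fun c q hq h => by
    rw [integral_congr_ae (Lp.coeFn_smul c q)]
    simp only [Pi.smul_apply]
    rw [integral_smul, hq h, smul_zero]

/-! ### Norms -/

/-- The squared `L²` norm `‖f‖²_{0,D}`. -/
def normSq0 {F : Type} [NormedAddCommGroup F] (D : Set (Vec d)) (f : Vec d → F) : ℝ :=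
  ∫ x in D, ‖f x‖ ^ 2

/-- `‖v‖_X`. -/
def normX (v : X T) : ℝ :=
  √(∑ K : T.Cell, (1 / Ω.diam ^ 2 * normSq0 K.1 (X.val v) + normSq0 K.1 (X.strain v)))

/-- `‖l‖_M`. -/
def normM {Γ : BoundaryPartition Ω} (l : M Γ T) : ℝ :=
  sInf ((fun τ : L2 Ω.carrier (Tens d) × L2 Ω.carrier (Vec d) =>
    √(∑ K : T.Cell, (normSq0 K.1 τ.1 + Ω.diam ^ 2 * normSq0 K.1 τ.2))) '' liftings Γ T l)

/-- The space `H = X × P`. -/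
abbrev H (Γ : BoundaryPartition Ω) (T : Mesh Ω) : Type := X T × P Γ

/-- `‖(v, q)‖_H = ‖v‖_X + ‖q‖_{0,Ω}`. -/
def normH {Γ : BoundaryPartition Ω} (x : H Γ T) : ℝ :=
  normX x.1 + √(normSq0 Ω.carrier x.2.1)

/-! ### Bilinear forms -/

variable {Γ : BoundaryPartition Ω}

/-- `a(v, u) = (2 μ ε(u), ε(v))`, the sum of the integrals over the elements. -/
def formA (mu : ℝ) (v u : X T) : ℝ :=
  ∑ K : T.Cell, ∫ x in K.1, inner ℝ ((2 * mu) • X.strain u x) (X.strain v x)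

/-- `b(v, l) = -∑_K ∫_{∂K} l · v ds`. -/
def formB (v : X T) (l : M Γ T) : ℝ :=
  -∑ K : T.Cell, (l.1 K).integral (X.toCell K v)

/-- `c(v, q) = (div v, q)`, the sum of the integrals over the elements. -/
def formC (v : X T) (q : P Γ) : ℝ :=
  ∑ K : T.Cell, ∫ x in K.1, X.div v x * q.1 x

/-- `(p, q)_Ω`. -/
def ipP (p q : P Γ) : ℝ := ∫ x in Ω.carrier, p.1 x * q.1 x

/-- `𝔞((u, p), (v, q)) = a(u, v) + c(v, p) - c(u, q) + (1/λ) (p, q)_Ω`. -/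
def formAA (mu lam : ℝ) (x y : H Γ T) : ℝ :=
  formA mu x.1 y.1 + formC y.1 x.2 - formC x.1 y.2 + 1 / lam * ipP x.2 y.2

/-- `𝔟((v, q), l) = b(v, l)`. -/
def formBB (y : H Γ T) (l : M Γ T) : ℝ := formB y.1 l

/-- `Ca` is a continuity constant of `𝔞` on `H × H`. -/
def IsContinuityConstA (Γ : BoundaryPartition Ω) (T : Mesh Ω) (mu lam Ca : ℝ) : Prop :=
  ∀ x y : H Γ T, |formAA mu lam x y| ≤ Ca * normH x * normH y

/-- `Cb` is a continuity constant of `𝔟` on `H × M`. -/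
def IsContinuityConstB (Γ : BoundaryPartition Ω) (T : Mesh Ω) (Cb : ℝ) : Prop :=
  ∀ (y : H Γ T) (l : M Γ T), |formBB y l| ≤ Cb * normH y * normM l

/-! ### The continuous and the discrete problems -/

/-- The data of the elasticity problem: the (positive) Lamé coefficients, the load `f`, the traction
`t_N` and the prescribed displacement `u_D`.

The traction is given by its action on the traces of the functions in `X`, that is by an element of
`∏_K H^{-1/2}(∂K, ℝ^d)` supported in `Γ_N`: it does not see the functions with vanishing trace on
`∂K ∩ Γ_N`. The prescribed displacement is the trace on `Γ_D` of the function `uD ∈ H¹(Ω, ℝ^d)`. -/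
structure ProblemData (Γ : BoundaryPartition Ω) (T : Mesh Ω) where
  mu : ℝ
  lam : ℝ
  mu_pos : 0 < mu
  lam_pos : 0 < lam
  f : L2 Ω.carrier (Vec d)
  tN : (K : T.Cell) → HMinusHalf (K : Set (Vec d))
  tN_support : ∀ (K : T.Cell), ∀ v ∈ H1Zero K.1 (frontier K.1 ∩ Γ.ΓN), (tN K).integral v = 0
  uD : H1 Ω.carrier

/-- The right-hand side `-(f, v)_Ω + ⟨t_N, v⟩_{Γ_N}`. -/
def ProblemData.load (dat : ProblemData Γ T) (v : X T) : ℝ :=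
  -(∫ x in Ω.carrier, inner ℝ (dat.f x) (X.val v x)) +
    ∑ K : T.Cell, (dat.tN K).integral (X.toCell K v)

/-- `⟨l, u_D⟩_{Γ_D}`. With `l = τ n` for some `τ ∈ H_{0,Γ_N}(div, Ω, 𝕊)` this is
`∫_{∂Ω} (τ n) · u_D ds`, which depends only on the trace of `u_D` on `Γ_D`; the contributions of the
interior faces to the sum below cancel. -/
def ProblemData.dirichlet (dat : ProblemData Γ T) (l : M Γ T) : ℝ :=
  ∑ K : T.Cell, (l.1 K).integral (X.toCell K (H1.toX T dat.uD))

/-- `((u, p), m)` solves the problem posed on the subspaces `Xh`, `Ph`, `Mh`, in its three-field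
form. -/
def IsSolution (dat : ProblemData Γ T) (Xh : Submodule ℝ (X T)) (Ph : Submodule ℝ (P Γ))
    (Mh : Submodule ℝ (M Γ T)) (s : H Γ T × M Γ T) : Prop :=
  (s.1.1 ∈ Xh ∧ s.1.2 ∈ Ph ∧ s.2 ∈ Mh) ∧
  (∀ v ∈ Xh, formA dat.mu v s.1.1 + formB v s.2 + formC v s.1.2 = dat.load v) ∧
  (∀ l ∈ Mh, formB s.1.1 l = -dat.dirichlet l) ∧
  (∀ q ∈ Ph, formC s.1.1 q - 1 / dat.lam * ipP s.1.2 q = 0)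

/-- `((u, p), m)` is an exact solution: it solves the problem on the full spaces `X`, `P`, `M`. -/
def IsExactSolution (dat : ProblemData Γ T) (s : H Γ T × M Γ T) : Prop :=
  IsSolution dat ⊤ ⊤ ⊤ s

/-- `((u_h, p_h), m_h)` solves the discrete problem in its saddle-point form, with the forms `𝔞` and
`𝔟` on `H_h = Xh × Ph` and `Mh`. -/
def IsSaddleSolution (dat : ProblemData Γ T) (Xh : Submodule ℝ (X T)) (Ph : Submodule ℝ (P Γ))
    (Mh : Submodule ℝ (M Γ T)) (s : H Γ T × M Γ T) : Prop :=
  (s.1 ∈ Xh.prod Ph ∧ s.2 ∈ Mh) ∧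
  (∀ y ∈ Xh.prod Ph, formAA dat.mu dat.lam s.1 y + formBB y s.2 = dat.load y.1) ∧
  (∀ l ∈ Mh, formBB s.1 l = -dat.dirichlet l)

/-- The kernel `N_h^b` of `b`. -/
def kernelB (Xh : Submodule ℝ (X T)) (Mh : Submodule ℝ (M Γ T)) : Set (X T) :=
  {v | v ∈ Xh ∧ ∀ l ∈ Mh, formB v l = 0}

/-- The kernel `N_h^HDP` of `𝔟`. -/
def kernelHDP (Xh : Submodule ℝ (X T)) (Ph : Submodule ℝ (P Γ)) (Mh : Submodule ℝ (M Γ T)) :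
    Set (H Γ T) :=
  {x | x ∈ Xh.prod Ph ∧ ∀ l ∈ Mh, formBB x l = 0}

/-- The inf-sup condition (B1) for `𝔞` on the kernel of `𝔟`, with constant `α`. Suprema are taken
over nonzero elements (and a supremum over the empty set counts as `0`). -/
def ConditionB1 (dat : ProblemData Γ T) (Xh : Submodule ℝ (X T)) (Ph : Submodule ℝ (P Γ))
    (Mh : Submodule ℝ (M Γ T)) (α : ℝ) : Prop :=
  ∀ x ∈ kernelHDP Xh Ph Mh,
    α * normH x ≤ ⨆ y : {y : H Γ T // y ∈ kernelHDP Xh Ph Mh ∧ y ≠ 0},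
      formAA dat.mu dat.lam x y.1 / normH y.1

/-- The inf-sup condition (B2) for `𝔟` on `H_h × Mh`, with constant `β`. -/
def ConditionB2 (Xh : Submodule ℝ (X T)) (Ph : Submodule ℝ (P Γ)) (Mh : Submodule ℝ (M Γ T))
    (β : ℝ) : Prop :=
  ∀ l ∈ Mh, β * normM l ≤ ⨆ y : {y : H Γ T // y ∈ Xh.prod Ph ∧ y ≠ 0},
    formBB y.1 l / normH y.1

end Forms

end HDP

end

/-!
The theorem is Brezzi's theory of saddle-point problems, applied to forms that turn out to be
bounded combinations of `L²(Ω)` inner products.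

The abstract part works with real vector spaces `E`, `F`, definite seminorms `p`, `r`, bilinear
maps `A`, `B` and finite-dimensional subspaces `V`, `W`. The two inf-sup conditions make the square
system injective, hence uniquely solvable (`existsUnique_saddle`). For the error estimate one has to
correct a competitor `z ∈ V` so that it satisfies the constraint, that is, to bound the distance of
`e = x_h - z` to the kernel of `B` by `C_b / β * ‖x - z‖` (`dist_saddleKernel_le`). `E` is not a
Hilbert space here, the norm on `X × P` being a sum, so the bound is obtained by duality: a
Hahn–Banach functional that realizes the distance vanishes on the kernel of `B`, so in finite
dimension it equals `B · l` for some `l ∈ W`, and `β * r l ≤ 1` by the inf-sup condition. The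
remaining part of `e` lies in the kernel, where the inf-sup condition for `A` applies
(`saddle_error_le`), and the one for `B` then controls the multiplier
(`saddle_multiplier_error_le`).

For the concrete spaces, the elements are convex and so cover `Ω` up to a null set; every sum of
integrals over the elements is then an inner product in `L²(Ω)`, and `‖·‖_X`, as well as the norm
of which `‖·‖_M` is a quotient, are Hilbert norms of `L²` fields. `‖·‖_X` is definite because weak
gradients are unique, and `‖·‖_M` because the normal trace of `τ` is bounded by the norm of `τ` in
`H(div)`. By Green's formula and the symmetry of `τ`, `b(v, l)` is the inner product of
`(τ, ρ_Ω div τ)` and `(ε(v), ρ_Ω⁻¹ v)`, up to sign, for every lifting `τ` of `l` (`formB_eq`); so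
`𝔟` is continuous with constant `1`. The form `𝔞` is continuous since the divergence is the trace of
the strain (`isContinuityConstA`). An exact solution satisfies the discrete equations as well, which
gives the Galerkin orthogonality that the abstract estimates require.
-/

namespace HDP

/-! ### Abstract saddle-point problems -/

section Saddle

variable {E F : Type*} [AddCommGroup E] [Module ℝ E] [AddCommGroup F] [Module ℝ F]

/-- Hahn–Banach: the distance, in a seminorm, from a point to a subspace is attained by a linear
functional that vanishes on the subspace and is dominated by the seminorm. -/
theorem exists_linearMap_eq_dist (p : Seminorm ℝ E) (W : Submodule ℝ E) (e : E) :
    ∃ f : E →ₗ[ℝ] ℝ, (∀ x, f x ≤ p x) ∧ (∀ w ∈ W, f w = 0) ∧ f e = ⨅ w : W, p (e - w) := by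
  -- The functional is extended from the span of `e` below the sublinear function `δ`, the distance
  -- to `W`; being dominated by `δ` forces it to vanish on `W`.
  set δ : E → ℝ := fun x => ⨅ w : W, p (x - w) with hδ
  have bdd : ∀ x, BddBelow (range fun w : W => p (x - w)) := fun x =>
    ⟨0, by rintro _ ⟨w, rfl⟩; exact apply_nonneg _ _⟩
  have le : ∀ x (w : W), δ x ≤ p (x - w) := fun x w => ciInf_le (bdd x) w
  have nn : ∀ x, 0 ≤ δ x := fun x => le_ciInf fun w => apply_nonneg _ _
  have smul_le : ∀ c : ℝ, 0 < c → ∀ x, δ (c • x) ≤ c * δ x := by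
    intro c hc x
    rw [hδ, Real.mul_iInf_of_nonneg hc.le]
    refine le_ciInf fun w => (le (c • x) (c • w)).trans ?_
    rw [Submodule.coe_smul, ← smul_sub, map_smul_eq_mul, Real.norm_of_nonneg hc.le]
  have hom : ∀ c : ℝ, 0 < c → ∀ x, δ (c • x) = c * δ x := by
    intro c hc x
    refine le_antisymm (smul_le c hc x) ?_
    have := smul_le c⁻¹ (inv_pos.2 hc) (c • x)
    rw [inv_smul_smul₀ hc.ne'] at this
    calc c * δ x ≤ c * (c⁻¹ * δ (c • x)) := by gcongr
      _ = δ (c • x) := by field_simp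
  have add_le : ∀ x y, δ (x + y) ≤ δ x + δ y := by
    intro x y
    refine le_ciInf_add_ciInf fun v w => (le _ (v + w)).trans ?_
    rw [Submodule.coe_add, add_sub_add_comm]
    exact map_add_le_add p _ _
  have fin : ∀ f : E →ₗ[ℝ] ℝ, (∀ x, f x ≤ δ x) →
      (∀ x, f x ≤ p x) ∧ ∀ w ∈ W, f w = 0 := by
    intro f hf
    have h0 : ∀ w ∈ W, f w ≤ 0 := fun w hw =>
      (hf w).trans ((le w ⟨w, hw⟩).trans (by simp))
    refine ⟨fun x => (hf x).trans (by simpa using le x 0), fun w hw => le_antisymm (h0 w hw) ?_⟩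
    have := h0 (-w) (neg_mem hw)
    rw [map_neg] at this
    linarith
  -- The span of `e` carries the functional `c • e ↦ c * δ e` only if `e ≠ 0`.
  by_cases he : e = 0
  · refine ⟨0, fun x => by simp, by simp, ?_⟩
    refine le_antisymm (nn e) ((le e 0).trans ?_)
    simp [he]
  obtain ⟨f, h1, h2⟩ := exists_extension_of_le_sublinear
    (LinearPMap.mkSpanSingleton e (δ e) he) δ hom add_le (by
      rintro ⟨x, hx⟩
      obtain ⟨c, rfl⟩ := Submodule.mem_span_singleton.1 hx
      rw [LinearPMap.mkSpanSingleton'_apply, RingHom.id_apply, smul_eq_mul]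
      rcases lt_or_ge 0 c with hc | hc
      · exact (hom c hc e).ge
      · exact (mul_nonpos_of_nonpos_of_nonneg hc (nn e)).trans (nn _))
  refine ⟨f, (fin f h2).1, (fin f h2).2, ?_⟩
  exact (h1 ⟨e, Submodule.mem_span_singleton_self e⟩).trans
    (LinearPMap.mkSpanSingleton'_apply_self _ _ _ _)

/-- The kernel of `B` relative to the subspaces `V` and `W`. -/
def saddleKernel (B : E →ₗ[ℝ] F →ₗ[ℝ] ℝ) (V : Submodule ℝ E) (W : Submodule ℝ F) :
    Submodule ℝ E where
  carrier := {x | x ∈ V ∧ ∀ l ∈ W, B x l = 0}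
  add_mem' := fun hx hy => ⟨add_mem hx.1 hy.1, fun l hl => by simp [hx.2 l hl, hy.2 l hl]⟩
  zero_mem' := ⟨zero_mem _, by simp⟩
  smul_mem' := fun c _ hx => ⟨V.smul_mem c hx.1, fun l hl => by simp [hx.2 l hl]⟩

variable (p : Seminorm ℝ E) (r : Seminorm ℝ F) (A : E →ₗ[ℝ] E →ₗ[ℝ] ℝ) (B : E →ₗ[ℝ] F →ₗ[ℝ] ℝ)
  (V : Submodule ℝ E) (W : Submodule ℝ F)

/-- Inf-sup condition for `A` on `N`. The supremum of the empty family is `0`. -/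
def InfSupA (N : Set E) (α : ℝ) : Prop :=
  ∀ x ∈ N, α * p x ≤ ⨆ y : {y : E // y ∈ N ∧ y ≠ 0}, A x y.1 / p y.1

/-- Inf-sup condition for `B` on `V × W`. The supremum of the empty family is `0`. -/
def InfSupB (β : ℝ) : Prop :=
  ∀ l ∈ W, β * r l ≤ ⨆ y : {y : E // y ∈ V ∧ y ≠ 0}, B y.1 l / p y.1

/-- `(x, m) ∈ V × W` solves the saddle-point problem with right-hand sides `φ`, `ψ`. -/
def SolvesSaddle (φ : E →ₗ[ℝ] ℝ) (ψ : F →ₗ[ℝ] ℝ) (s : E × F) : Prop :=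
  (s.1 ∈ V ∧ s.2 ∈ W) ∧ (∀ y ∈ V, A s.1 y + B y s.2 = φ y) ∧ ∀ l ∈ W, B s.1 l = ψ l

variable {p r A B V W} {α β : ℝ}

/-- A bound for the functional on the right of an inf-sup condition bounds the supremum. The
supremum over an empty set is the junk value `0`, which is why `c` has to be nonnegative. -/
theorem iSup_div_le {S : Set E} {f : E → ℝ} {c : ℝ} (hc : 0 ≤ c)
    (h : ∀ y ∈ S, f y ≤ c * p y) : ⨆ y : {y : E // y ∈ S ∧ y ≠ 0}, f y.1 / p y.1 ≤ c :=
  Real.iSup_le (fun y => div_le_of_le_mul₀ (apply_nonneg _ _) hc (h _ y.2.1)) hc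

theorem InfSupA.le {N : Set E} (h : InfSupA p A N α) {x : E} (hx : x ∈ N) {c : ℝ} (hc : 0 ≤ c)
    (hb : ∀ y ∈ N, A x y ≤ c * p y) : α * p x ≤ c :=
  (h x hx).trans (iSup_div_le (f := A x) hc hb)

theorem InfSupB.le (h : InfSupB p r B V W β) {l : F} (hl : l ∈ W) {c : ℝ} (hc : 0 ≤ c)
    (hb : ∀ y ∈ V, B y l ≤ c * p y) : β * r l ≤ c :=
  (h l hl).trans (iSup_div_le (S := V) (f := fun y => B y l) hc hb)

/-- The two inf-sup conditions make the square linear system injective, hence bijective. -/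
theorem existsUnique_saddle [FiniteDimensional ℝ V] [FiniteDimensional ℝ W]
    (hp : ∀ x, p x = 0 → x = 0) (hr : ∀ l, r l = 0 → l = 0) (hα : 0 < α) (hβ : 0 < β)
    (h1 : InfSupA p A (saddleKernel B V W) α) (h2 : InfSupB p r B V W β)
    (φ : E →ₗ[ℝ] ℝ) (ψ : F →ₗ[ℝ] ℝ) : ∃! s, SolvesSaddle A B V W φ ψ s := by
  let L : (V × W) →ₗ[ℝ] Module.Dual ℝ V × Module.Dual ℝ W :=
    { toFun := fun s => ((A s.1).comp V.subtype + (B.flip s.2).comp V.subtype,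
        (B s.1).comp W.subtype)
      map_add' := fun s t => by
        refine Prod.ext ?_ ?_ <;> ext y <;> simp
        ring
      map_smul' := fun c s => by
        refine Prod.ext ?_ ?_ <;> ext y <;> simp }
  have hinj : Function.Injective L := by
    rw [injective_iff_map_eq_zero]
    rintro ⟨⟨x, hx⟩, ⟨m, hm⟩⟩ h0
    have e1 : ∀ y ∈ V, A x y + B y m = 0 := fun y hy => by
      simpa [L] using LinearMap.congr_fun (congrArg Prod.fst h0) ⟨y, hy⟩
    have e2 : ∀ l ∈ W, B x l = 0 := fun l hl => by
      simpa [L] using LinearMap.congr_fun (congrArg Prod.snd h0) ⟨l, hl⟩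
    have k1 : α * p x ≤ 0 := h1.le (x := x) ⟨hx, e2⟩ le_rfl fun y hy => by
      have := e1 y hy.1
      rw [hy.2 m hm] at this
      linarith
    have x0 : x = 0 := hp x (le_antisymm (nonpos_of_mul_nonpos_right k1 hα) (apply_nonneg _ _))
    have k2 : β * r m ≤ 0 := h2.le hm le_rfl fun y hy => by
      have := e1 y hy
      rw [x0, map_zero, LinearMap.zero_apply] at this
      linarith
    have m0 : m = 0 := hr m (le_antisymm (nonpos_of_mul_nonpos_right k2 hβ) (apply_nonneg _ _))
    subst x0 m0
    rfl
  have hbij : Function.Bijective L := by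
    refine ⟨hinj, (LinearMap.injective_iff_surjective_of_finrank_eq_finrank ?_).1 hinj⟩
    simp [Module.finrank_prod, Subspace.dual_finrank_eq]
  have key : ∀ s : V × W, L s = (φ.comp V.subtype, ψ.comp W.subtype) ↔
      SolvesSaddle A B V W φ ψ (s.1, s.2) := by
    intro s
    simp [SolvesSaddle, Prod.ext_iff, LinearMap.ext_iff, L]
  obtain ⟨s, hs, hu⟩ := hbij.existsUnique (φ.comp V.subtype, ψ.comp W.subtype)
  refine ⟨(s.1, s.2), (key s).1 hs, fun t ht => ?_⟩
  rw [← hu (⟨t.1, ht.1.1⟩, ⟨t.2, ht.1.2⟩) ((key _).2 ht)]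

/-- The inf-sup condition for `B` bounds the distance from `e ∈ V` to the kernel of `B` by the size
of `B e`. A functional that realizes this distance annihilates the kernel, so it is of the form
`B · l` with `l ∈ W`, and the inf-sup condition bounds `l`. -/
theorem dist_saddleKernel_le [FiniteDimensional ℝ W] (hβ : 0 < β) (h2 : InfSupB p r B V W β)
    {e : E} (he : e ∈ V) {c : ℝ} (hc : 0 ≤ c) (hb : ∀ l ∈ W, B e l ≤ c * r l) :
    ⨅ w : saddleKernel B V W, p (e - w) ≤ c / β := by
  obtain ⟨f, f1, f2, f3⟩ := exists_linearMap_eq_dist p (saddleKernel B V W) e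
  let b := Module.finBasis ℝ W
  -- `f` vanishes wherever the finitely many functionals `B · (b i)` vanish on `V`.
  have hspan : f.comp V.subtype ∈
      Submodule.span ℝ (range fun i => (B.flip (b i)).comp V.subtype) := by
    refine mem_span_of_iInf_ker_le_ker fun y hy => ?_
    rw [LinearMap.mem_ker]
    refine f2 y ⟨y.2, fun l hl => ?_⟩
    have hz : (B y).comp W.subtype = 0 := b.ext fun i => by
      simpa using (Submodule.mem_iInf _).1 hy i
    simpa using LinearMap.congr_fun hz ⟨l, hl⟩
  obtain ⟨a, ha⟩ := (Submodule.mem_span_range_iff_exists_fun ℝ).1 hspan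
  set l : F := ∑ i, a i • (b i : F) with hl
  have hlW : l ∈ W := Submodule.sum_mem _ fun i _ => W.smul_mem _ (b i).2
  have hBl : ∀ y ∈ V, B y l = f y := fun y hy => by
    have := LinearMap.congr_fun ha ⟨y, hy⟩
    simpa [hl] using this
  have hle : β * r l ≤ 1 := h2.le hlW zero_le_one fun y hy => by
    rw [hBl y hy, one_mul]
    exact f1 y
  rw [← f3, ← hBl e he, le_div_iff₀ hβ]
  calc B e l * β ≤ c * r l * β := by gcongr; exact hb l hlW
    _ = c * (β * r l) := by ring
    _ ≤ c := mul_le_of_le_one_right hc hle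

/-- Quasi-optimality in the first unknown, against fixed competitors `z` and `l`. -/
theorem saddle_error_le [FiniteDimensional ℝ W] (hα : 0 < α) (hβ : 0 < β)
    (h1 : InfSupA p A (saddleKernel B V W) α) (h2 : InfSupB p r B V W β) {Ca Cb : ℝ}
    (hCa : 0 ≤ Ca) (hCb : 0 ≤ Cb) (hA : ∀ x y, |A x y| ≤ Ca * p x * p y)
    (hB : ∀ y l, |B y l| ≤ Cb * p y * r l) {x xh : E} {m mh : F} (hxh : xh ∈ V) (hmh : mh ∈ W)
    (o1 : ∀ y ∈ V, A (x - xh) y + B y (m - mh) = 0) (o2 : ∀ l ∈ W, B (x - xh) l = 0)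
    {z : E} (hz : z ∈ V) {l : F} (hl : l ∈ W) :
    p (x - xh) ≤ (1 + Ca / α) * (1 + Cb / β) * p (x - z) + Cb / α * r (m - l) := by
  set e := xh - z with he
  have heV : e ∈ V := sub_mem hxh hz
  have hxe : x - xh = (x - z) - e := by rw [he]; abel
  have hdist : ⨅ w : saddleKernel B V W, p (e - w) ≤ Cb * p (x - z) / β := by
    refine dist_saddleKernel_le hβ h2 heV (by positivity) fun l' hl' => ?_
    have := o2 l' hl'
    rw [hxe, map_sub, LinearMap.sub_apply] at this
    have := (le_abs_self _).trans (hB (x - z) l')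
    linarith
  set c := Ca * p (x - z) + Cb * r (m - l) with hc
  -- For any `w` in the kernel, split `e = w + (e - w)`: the inf-sup condition for `A` and the
  -- orthogonality relations control `w`, and `e - w` can be made as small as the distance of `e`
  -- to the kernel.
  have hker : ∀ w : saddleKernel B V W, p e ≤ c / α + (1 + Ca / α) * p (e - w) := by
    rintro ⟨w, hw⟩
    have hw' : α * p w ≤ c + Ca * p (e - w) := by
      refine h1.le hw (by positivity) fun y hy => ?_
      have q1 := o1 y hy.1
      have q2 : B y (l - mh) = 0 := hy.2 _ (sub_mem hl hmh)
      have q3 : A w y = A (x - z) y + B y (m - l) - A (e - w) y := by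
        rw [hxe] at q1
        simp only [map_sub, LinearMap.sub_apply] at q1 q2 ⊢
        linarith
      have b1 := (abs_le.1 (hA (x - z) y)).2
      have b2 := (abs_le.1 (hB y (m - l))).2
      have b3 := (abs_le.1 (hA (e - w) y)).1
      rw [q3, hc]
      linarith
    have htri : p e ≤ p w + p (e - w) := by
      simpa using map_add_le_add p w (e - w)
    have hw'' : p w ≤ (c + Ca * p (e - w)) / α := by
      rw [le_div_iff₀ hα]
      linarith
    calc p e ≤ (c + Ca * p (e - w)) / α + p (e - w) := htri.trans (by gcongr)
      _ = c / α + (1 + Ca / α) * p (e - w) := by ring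
  have hpe : p e ≤ c / α + (1 + Ca / α) * (Cb * p (x - z) / β) := by
    have h3 : p e - c / α ≤ (1 + Ca / α) * ⨅ w : saddleKernel B V W, p (e - w) := by
      rw [Real.mul_iInf_of_nonneg (by positivity)]
      exact le_ciInf fun w => by linarith [hker w]
    have h4 := mul_le_mul_of_nonneg_left hdist (by positivity : 0 ≤ 1 + Ca / α)
    linarith
  calc p (x - xh) ≤ p (x - z) + p e := by rw [hxe]; exact map_sub_le_add p _ _
    _ ≤ p (x - z) + (c / α + (1 + Ca / α) * (Cb * p (x - z) / β)) := by gcongr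
    _ = _ := by rw [hc]; ring

/-- Quasi-optimality in the multiplier, relative to the error of the first unknown. -/
theorem saddle_multiplier_error_le (hβ : 0 < β) (h2 : InfSupB p r B V W β) {Ca Cb : ℝ}
    (hCa : 0 ≤ Ca) (hCb : 0 ≤ Cb) (hA : ∀ x y, |A x y| ≤ Ca * p x * p y)
    (hB : ∀ y l, |B y l| ≤ Cb * p y * r l) {x xh : E} {m mh : F} (hmh : mh ∈ W)
    (o1 : ∀ y ∈ V, A (x - xh) y + B y (m - mh) = 0) {l : F} (hl : l ∈ W) :
    r (m - mh) ≤ Ca / β * p (x - xh) + (1 + Cb / β) * r (m - l) := by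
  have hle : β * r (l - mh) ≤ Ca * p (x - xh) + Cb * r (m - l) := by
    refine h2.le (sub_mem hl hmh) (by positivity) fun y hy => ?_
    have q1 := o1 y hy
    have q2 : B y (l - mh) = -A (x - xh) y - B y (m - l) := by
      simp only [map_sub] at q1 ⊢
      linarith
    have b1 := (abs_le.1 (hA (x - xh) y)).1
    have b2 := (abs_le.1 (hB y (m - l))).1
    rw [q2]
    linarith
  have htri : r (m - mh) ≤ r (m - l) + r (l - mh) := by
    simpa using map_add_le_add r (m - l) (l - mh)
  have hle' : r (l - mh) ≤ (Ca * p (x - xh) + Cb * r (m - l)) / β := by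
    rw [le_div_iff₀ hβ]
    linarith
  calc r (m - mh) ≤ r (m - l) + (Ca * p (x - xh) + Cb * r (m - l)) / β := htri.trans (by gcongr)
    _ = _ := by ring

end Saddle

variable {d : ℕ} {Ω : PolyhedralDomain d} {T : Mesh Ω} {Γ : BoundaryPartition Ω}

/-! ### Sums over the elements as integrals over the domain -/

theorem Mesh.isOpen_cell (T : Mesh Ω) {K : Set (Vec d)} (hK : K ∈ T.cells) : IsOpen K := by
  obtain ⟨-, s, rfl⟩ := T.polytope K hK
  exact isOpen_interior

theorem Mesh.convex_cell (T : Mesh Ω) {K : Set (Vec d)} (hK : K ∈ T.cells) : Convex ℝ K := by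
  obtain ⟨-, s, rfl⟩ := T.polytope K hK
  exact (convex_convexHull ℝ _).interior

/-- Since the boundary of a convex set is negligible, the elements cover `Ω` up to a null set. -/
theorem Mesh.iUnion_cells_ae_eq (T : Mesh Ω) :
    (⋃ K ∈ T.cells, K) =ᵐ[volume] Ω.carrier := by
  have hsub : (⋃ K ∈ T.cells, K) ≤ Ω.carrier := iUnion₂_subset T.subset
  refine hsub.eventuallyLE.antisymm ?_
  have h0 : volume (⋃ K ∈ T.cells, frontier K) = 0 :=
    (measure_biUnion_null_iff T.cells.countable_toSet).2 fun K hK =>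
      (T.convex_cell hK).addHaar_frontier volume
  have hcov : Ω.carrier ≤ (⋃ K ∈ T.cells, K) ∪ ⋃ K ∈ T.cells, frontier K := by
    intro x hx
    have := T.cover ▸ subset_closure hx
    simp only [mem_iUnion, mem_union] at this ⊢
    obtain ⟨K, hK, hx⟩ := this
    rw [closure_eq_self_union_frontier] at hx
    exact hx.imp (fun h => ⟨K, hK, h⟩) fun h => ⟨K, hK, h⟩
  exact hcov.eventuallyLE.trans (union_ae_eq_left_of_ae_eq_empty (ae_eq_empty.2 h0)).le

theorem Mesh.ae_of_cells (T : Mesh Ω) {q : Vec d → Prop}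
    (h : ∀ K ∈ T.cells, ∀ᵐ x ∂(volume.restrict K), q x) :
    ∀ᵐ x ∂(volume.restrict Ω.carrier), q x := by
  rw [← Measure.restrict_congr_set T.iUnion_cells_ae_eq, ae_restrict_biUnion_finset_iff]
  exact h

theorem Mesh.sum_setIntegral (T : Mesh Ω) {g : Vec d → ℝ} (hg : IntegrableOn g Ω.carrier) :
    ∑ K : T.Cell, ∫ x in K.1, g x = ∫ x in Ω.carrier, g x := by
  rw [← setIntegral_congr_set T.iUnion_cells_ae_eq, integral_biUnion_finset T.cells
    (fun K hK => (T.isOpen_cell hK).measurableSet)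
    (fun K hK K' hK' h => T.disjoint K hK K' hK' h) fun K hK => hg.mono_set (T.subset K hK)]
  exact Finset.sum_coe_sort T.cells fun K => ∫ x in K, g x

theorem Mesh.sum_setIntegral_eq_inner (T : Mesh Ω) {F : Type} [NormedAddCommGroup F]
    [InnerProductSpace ℝ F] (f g : L2 Ω.carrier F) {h : Vec d → ℝ}
    (hh : h =ᵐ[volume.restrict Ω.carrier] fun x => inner ℝ (f x) (g x)) :
    ∑ K : T.Cell, ∫ x in K.1, h x = inner ℝ f g := by
  have hi : Integrable h (volume.restrict Ω.carrier) := (L2.integrable_inner f g).congr hh.symm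
  rw [T.sum_setIntegral hi, L2.inner_def, integral_congr_ae hh]

theorem normSq0_domain {F : Type} [NormedAddCommGroup F] [InnerProductSpace ℝ F]
    (f : L2 Ω.carrier F) : normSq0 Ω.carrier f = ‖f‖ ^ 2 := by
  rw [← real_inner_self_eq_norm_sq, L2.inner_def]
  simp only [real_inner_self_eq_norm_sq]
  rfl

theorem Mesh.sum_normSq0 (T : Mesh Ω) {F : Type} [NormedAddCommGroup F] [InnerProductSpace ℝ F]
    (f : L2 Ω.carrier F) {h : Vec d → F} (hh : h =ᵐ[volume.restrict Ω.carrier] f) :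
    ∑ K : T.Cell, normSq0 K.1 h = ‖f‖ ^ 2 := by
  rw [← real_inner_self_eq_norm_sq]
  refine T.sum_setIntegral_eq_inner f f ?_
  filter_upwards [hh] with x hx
  rw [hx, real_inner_self_eq_norm_sq]

theorem PolyhedralDomain.diam_pos (hd : 0 < d) (Ω : PolyhedralDomain d) : 0 < Ω.diam := by
  obtain ⟨x, hx⟩ := Ω.connected.nonempty
  have : Nonempty (Fin d) := ⟨⟨0, hd⟩⟩
  exact Metric.diam_pos (infinite_of_mem_nhds x (Ω.isOpen.mem_nhds hx)).nontrivial Ω.bounded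

/-! ### Strain and divergence as operators into `L²` -/

/-- The symmetric part of a tensor. -/
noncomputable def symPart (d : ℕ) : Tens d →L[ℝ] Tens d :=
  LinearMap.toContinuousLinearMap
    { toFun := fun G => WithLp.toLp 2 fun k => (G (k.1, k.2) + G (k.2, k.1)) / 2
      map_add' := fun G H => by
        ext k
        simp only [PiLp.add_apply]
        ring
      map_smul' := fun c G => by
        ext k
        simp only [PiLp.smul_apply, smul_eq_mul, RingHom.id_apply]
        ring }

@[simp]
theorem symPart_apply (G : Tens d) (k : Fin d × Fin d) :
    symPart d G k = (G (k.1, k.2) + G (k.2, k.1)) / 2 := rfl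

/-- The trace of a tensor. -/
noncomputable def tensTrace (d : ℕ) : Tens d →L[ℝ] ℝ :=
  ∑ i : Fin d, EuclideanSpace.proj (i, i)

@[simp]
theorem tensTrace_apply (G : Tens d) : tensTrace d G = ∑ i, G (i, i) := by
  simp [tensTrace]

theorem tensTrace_symPart (G : Tens d) : tensTrace d (symPart d G) = tensTrace d G := by
  simp

theorem inner_symPart {τ : Tens d} (hτ : ∀ i j, τ (i, j) = τ (j, i)) (G : Tens d) :
    inner ℝ τ (symPart d G) = inner ℝ τ G := by
  have hswap : ∑ k : Fin d × Fin d, G (k.2, k.1) * τ k = ∑ k : Fin d × Fin d, G k * τ k :=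
    Fintype.sum_equiv (Equiv.prodComm _ _) _ _ fun k => by
      rw [Equiv.prodComm_apply, hτ k.1 k.2]
      rfl
  simp only [PiLp.inner_apply, symPart_apply, RCLike.inner_apply, conj_trivial]
  calc ∑ k : Fin d × Fin d, (G k + G (k.2, k.1)) / 2 * τ k
      = (∑ k : Fin d × Fin d, G k * τ k + ∑ k : Fin d × Fin d, G (k.2, k.1) * τ k) / 2 := by
        rw [← Finset.sum_add_distrib, Finset.sum_div]
        exact Finset.sum_congr rfl fun k _ => by ring
    _ = _ := by rw [hswap]; ring

/-- The element-wise strain as an element of `L²(Ω)`. -/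
noncomputable def strainL2 (T : Mesh Ω) : X T →ₗ[ℝ] L2 Ω.carrier (Tens d) :=
  ((symPart d).compLpL 2 (volume.restrict Ω.carrier)).toLinearMap ∘ₗ
    LinearMap.snd ℝ _ _ ∘ₗ (X T).subtype

theorem strainL2_ae (v : X T) : X.strain v =ᵐ[volume.restrict Ω.carrier] strainL2 T v := by
  filter_upwards [(symPart d).coeFn_compLpL (p := 2) v.1.2] with x hx
  exact hx.symm

/-- The element-wise divergence as an element of `L²(Ω)`. It is taken of the strain, which makes it
visible that the strain controls it. -/
noncomputable def divL2 (T : Mesh Ω) : X T →ₗ[ℝ] L2 Ω.carrier ℝ :=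
  ((tensTrace d).compLpL 2 (volume.restrict Ω.carrier)).toLinearMap ∘ₗ strainL2 T

theorem divL2_ae (v : X T) : X.div v =ᵐ[volume.restrict Ω.carrier] divL2 T v := by
  filter_upwards [(tensTrace d).coeFn_compLpL (p := 2) (strainL2 T v),
    (symPart d).coeFn_compLpL (p := 2) v.1.2] with x h1 h2
  have h3 : strainL2 T v x = symPart d (v.1.2 x) := h2
  have h4 : divL2 T v x = tensTrace d (strainL2 T v x) := h1
  rw [h4, h3, tensTrace_symPart, tensTrace_apply]
  rfl

theorem norm_divL2_le (v : X T) : ‖divL2 T v‖ ≤ ‖tensTrace d‖ * ‖strainL2 T v‖ :=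
  (tensTrace d).norm_compLp_le _

/-! ### The norms as seminorms -/

/-- `v ↦ (ε(v), ρ_Ω⁻¹ v)`, whose Hilbert norm is `‖v‖_X`. -/
noncomputable def embX (T : Mesh Ω) :
    X T →ₗ[ℝ] WithLp 2 (L2 Ω.carrier (Tens d) × L2 Ω.carrier (Vec d)) :=
  (WithLp.linearEquiv 2 ℝ _).symm.toLinearMap ∘ₗ
    (strainL2 T).prod (Ω.diam⁻¹ • (LinearMap.fst ℝ _ _ ∘ₗ (X T).subtype))

/-- `τ ↦ (τ, ρ_Ω div τ)`, whose Hilbert norm enters the definition of `‖l‖_M`. -/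
noncomputable def embHdiv (Ω : PolyhedralDomain d) :
    L2 Ω.carrier (Tens d) × L2 Ω.carrier (Vec d) →ₗ[ℝ]
      WithLp 2 (L2 Ω.carrier (Tens d) × L2 Ω.carrier (Vec d)) :=
  (WithLp.linearEquiv 2 ℝ _).symm.toLinearMap ∘ₗ
    (LinearMap.fst ℝ _ _).prod (Ω.diam • LinearMap.snd ℝ _ _)

theorem norm_embX_sq (v : X T) :
    ‖embX T v‖ ^ 2 = ‖strainL2 T v‖ ^ 2 + (Ω.diam⁻¹ * ‖v.1.1‖) ^ 2 := by
  rw [WithLp.prod_norm_sq_eq_of_L2]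
  simp [embX, norm_smul, mul_pow]

theorem norm_embHdiv_sq (τ : L2 Ω.carrier (Tens d) × L2 Ω.carrier (Vec d)) :
    ‖embHdiv Ω τ‖ ^ 2 = ‖τ.1‖ ^ 2 + (Ω.diam * ‖τ.2‖) ^ 2 := by
  rw [WithLp.prod_norm_sq_eq_of_L2]
  simp [embHdiv, norm_smul, mul_pow]

theorem inner_embHdiv_embX (hd : 0 < d) (τ : L2 Ω.carrier (Tens d) × L2 Ω.carrier (Vec d))
    (v : X T) : inner ℝ (embHdiv Ω τ) (embX T v) =
      inner ℝ τ.1 (strainL2 T v) + inner ℝ τ.2 v.1.1 := by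
  have := (Ω.diam_pos hd).ne'
  rw [WithLp.prod_inner_apply]
  simp [embHdiv, embX, real_inner_smul_left, real_inner_smul_right, this]

theorem normX_eq (v : X T) : normX v = ‖embX T v‖ := by
  rw [normX, ← Real.sqrt_sq (norm_nonneg (embX T v)), norm_embX_sq, Finset.sum_add_distrib,
    ← Finset.mul_sum, T.sum_normSq0 (strainL2 T v) (strainL2_ae v),
    T.sum_normSq0 v.1.1 (h := X.val v) EventuallyEq.rfl]
  congr 1
  rw [one_div, ← inv_pow]
  ring

theorem norm_strainL2_le (v : X T) : ‖strainL2 T v‖ ≤ normX v := by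
  rw [normX_eq]
  refine abs_le_of_sq_le_sq' ?_ (norm_nonneg _) |>.2
  rw [norm_embX_sq]
  exact le_add_of_nonneg_right (sq_nonneg _)

/-- A function in `X` that vanishes almost everywhere has vanishing element-wise weak gradient. -/
theorem eq_zero_of_normX_eq_zero (hd : 0 < d) {v : X T} (h : normX v = 0) : v = 0 := by
  have hdiam := Ω.diam_pos hd
  have hv : v.1.1 = 0 := by
    have h1 := norm_embX_sq v
    rw [← normX_eq, h] at h1
    have h2 : (Ω.diam⁻¹ * ‖v.1.1‖) ^ 2 = 0 := by
      refine le_antisymm ?_ (sq_nonneg _)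
      linarith [sq_nonneg (‖strainL2 T v‖)]
    simpa [hdiam.ne'] using h2
  have hG : v.1.2 = 0 := by
    refine (Lp.eq_zero_iff_ae_eq_zero).2 (T.ae_of_cells fun K hK => ?_)
    have hs := T.subset K hK
    have hv0 : v.1.1 =ᵐ[volume.restrict K] 0 :=
      ae_restrict_of_subset' hs ((Lp.eq_zero_iff_ae_eq_zero).1 hv)
    exact IsWeakGradient.unique (T.isOpen_cell hK) (memLp_restrict hs v.1.2) MemLp.zero
      ((v.2 K hK).congr hv0 EventuallyEq.rfl) IsWeakGradient.zero
  exact Subtype.ext (Prod.ext hv hG)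

/-- `‖·‖_H` as a seminorm. -/
noncomputable def seminormH (Γ : BoundaryPartition Ω) (T : Mesh Ω) : Seminorm ℝ (H Γ T) :=
  ((normSeminorm ℝ _).comp (embX T)).comp (LinearMap.fst ℝ _ _) +
    ((normSeminorm ℝ _).comp (P Γ).subtype).comp (LinearMap.snd ℝ _ _)

theorem seminormH_eq (x : H Γ T) : seminormH Γ T x = normX x.1 + ‖x.2.1‖ := by
  rw [normX_eq]
  rfl

theorem seminormH_apply (x : H Γ T) : seminormH Γ T x = normH x := by
  rw [seminormH_eq, normH, normSq0_domain, Real.sqrt_sq (norm_nonneg _)]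

theorem normX_le (x : H Γ T) : normX x.1 ≤ seminormH Γ T x := by
  rw [seminormH_eq]
  exact le_add_of_nonneg_right (norm_nonneg _)

theorem norm_pressure_le (x : H Γ T) : ‖x.2.1‖ ≤ seminormH Γ T x := by
  rw [seminormH_eq, normX_eq]
  exact le_add_of_nonneg_left (norm_nonneg _)

theorem eq_zero_of_seminormH_eq_zero (hd : 0 < d) {x : H Γ T} (h : seminormH Γ T x = 0) :
    x = 0 := by
  have h1 : normX x.1 = 0 :=
    le_antisymm (h ▸ normX_le x) (normX_eq x.1 ▸ norm_nonneg _)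
  have h2 : ‖x.2.1‖ = 0 := le_antisymm (h ▸ norm_pressure_le x) (norm_nonneg _)
  exact Prod.ext (eq_zero_of_normX_eq_zero hd h1) (Subtype.ext (norm_eq_zero.1 h2))

theorem normM_eq (l : M Γ T) :
    normM l = sInf ((fun τ => ‖embHdiv Ω τ‖) '' liftings Γ T l) := by
  rw [normM]
  congr 2
  funext τ
  rw [← Real.sqrt_sq (norm_nonneg (embHdiv Ω τ)), norm_embHdiv_sq, Finset.sum_add_distrib,
    ← Finset.mul_sum, T.sum_normSq0 τ.1 (h := τ.1) EventuallyEq.rfl,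
    T.sum_normSq0 τ.2 (h := τ.2) EventuallyEq.rfl, mul_pow]

theorem liftings_nonempty (l : M Γ T) : (liftings Γ T l).Nonempty := l.2

theorem normM_le {l : M Γ T} {τ : L2 Ω.carrier (Tens d) × L2 Ω.carrier (Vec d)}
    (h : τ ∈ liftings Γ T l) : normM l ≤ ‖embHdiv Ω τ‖ := by
  rw [normM_eq]
  exact csInf_le ⟨0, by rintro _ ⟨σ, -, rfl⟩; exact norm_nonneg _⟩ ⟨τ, h, rfl⟩

theorem le_normM {l : M Γ T} {c : ℝ} (h : ∀ τ ∈ liftings Γ T l, c ≤ ‖embHdiv Ω τ‖) :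
    c ≤ normM l := by
  rw [normM_eq]
  refine le_csInf ((liftings_nonempty l).image _) ?_
  rintro _ ⟨τ, hτ, rfl⟩
  exact h τ hτ

theorem le_mul_normM {l : M Γ T} {c k : ℝ} (hk : 0 ≤ k)
    (h : ∀ τ ∈ liftings Γ T l, c ≤ k * ‖embHdiv Ω τ‖) : c ≤ k * normM l := by
  rcases hk.eq_or_lt with rfl | hk
  · obtain ⟨τ, hτ⟩ := liftings_nonempty l
    simpa using h τ hτ
  · rw [← div_le_iff₀' hk]
    exact le_normM fun τ hτ => (div_le_iff₀' hk).2 (h τ hτ)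

theorem liftings_add {l l' : M Γ T} {τ σ : L2 Ω.carrier (Tens d) × L2 Ω.carrier (Vec d)}
    (h : τ ∈ liftings Γ T l) (h' : σ ∈ liftings Γ T l') : τ + σ ∈ liftings Γ T (l + l') := by
  refine ⟨add_mem h.1 h'.1, fun K v => ?_⟩
  rw [green_add (T.subset K K.2), ← h.2 K v, ← h'.2 K v]
  rfl

theorem liftings_smul (c : ℝ) {l : M Γ T} {τ : L2 Ω.carrier (Tens d) × L2 Ω.carrier (Vec d)}
    (h : τ ∈ liftings Γ T l) : c • τ ∈ liftings Γ T (c • l) := by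
  refine ⟨Submodule.smul_mem _ c h.1, fun K v => ?_⟩
  rw [green_smul (T.subset K K.2), ← h.2 K v]
  rfl

/-- `‖·‖_M` as a seminorm. -/
noncomputable def seminormM (Γ : BoundaryPartition Ω) (T : Mesh Ω) : Seminorm ℝ (M Γ T) :=
  Seminorm.ofSMulLE normM
    (le_antisymm
      ((normM_le ⟨zero_mem _, fun K v => by rw [green_zero (T.subset K K.2)]; rfl⟩).trans
        (by rw [map_zero, norm_zero]))
      (le_normM fun τ _ => norm_nonneg _))
    (fun l l' => by
      have key : ∀ σ ∈ liftings Γ T l', normM (l + l') - ‖embHdiv Ω σ‖ ≤ normM l := fun σ hσ =>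
        le_normM fun τ hτ => by
          have h1 := normM_le (liftings_add hτ hσ)
          rw [map_add] at h1
          have h2 := norm_add_le (embHdiv Ω τ) (embHdiv Ω σ)
          linarith
      have : normM (l + l') - normM l ≤ normM l' := le_normM fun σ hσ => by
        linarith [key σ hσ]
      linarith)
    (fun c l => le_mul_normM (norm_nonneg c) fun τ hτ => by
      have := normM_le (liftings_smul c hτ)
      rwa [map_smul, norm_smul] at this)

theorem seminormM_apply (l : M Γ T) : seminormM Γ T l = normM l := rfl

theorem norm_restrictL2_le {F : Type} [NormedAddCommGroup F] [NormedSpace ℝ F]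
    {D D' : Set (Vec d)} (h : D' ⊆ D) (f : L2 D F) : ‖restrictL2 h f‖ ≤ ‖f‖ := by
  rw [Lp.norm_def f]
  refine (Lp.norm_toLp _ (memLp_restrict h f)).trans_le
    (ENNReal.toReal_mono (Lp.eLpNorm_ne_top f) ?_)
  exact eLpNorm_mono_measure _ (Measure.restrict_mono h le_rfl)

/-- The action of `l` on a trace is bounded by the norm of any lifting, hence by `‖l‖_M`. -/
theorem eq_zero_of_normM_eq_zero (hd : 0 < d) {l : M Γ T} (h : normM l = 0) : l = 0 := by
  have hdiam := Ω.diam_pos hd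
  have key : ∀ (K : T.Cell) (v : H1 K.1), (l.1 K).integral v = 0 := by
    intro K v
    have hK := T.subset K K.2
    have hle : |(l.1 K).integral v| ≤ (Ω.diam⁻¹ * ‖v.1.1‖ + ‖v.1.2‖) * normM l := by
      refine le_mul_normM (by positivity) fun τ hτ => ?_
      have n1 : ‖τ.1‖ ≤ ‖embHdiv Ω τ‖ := by
        refine (abs_le_of_sq_le_sq' ?_ (norm_nonneg _)).2
        rw [norm_embHdiv_sq]
        exact le_add_of_nonneg_right (sq_nonneg _)
      have n2 : ‖τ.2‖ ≤ Ω.diam⁻¹ * ‖embHdiv Ω τ‖ := by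
        rw [← div_eq_inv_mul, le_div_iff₀' hdiam]
        refine (abs_le_of_sq_le_sq' ?_ (norm_nonneg _)).2
        rw [norm_embHdiv_sq]
        exact le_add_of_nonneg_left (sq_nonneg _)
      rw [hτ.2 K v, green_eq hK]
      calc |inner ℝ (restrictL2 hK τ.2) v.1.1 + inner ℝ (restrictL2 hK τ.1) v.1.2|
          ≤ ‖restrictL2 hK τ.2‖ * ‖v.1.1‖ + ‖restrictL2 hK τ.1‖ * ‖v.1.2‖ :=
            (abs_add_le _ _).trans
              (add_le_add (abs_real_inner_le_norm _ _) (abs_real_inner_le_norm _ _))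
        _ ≤ Ω.diam⁻¹ * ‖embHdiv Ω τ‖ * ‖v.1.1‖ + ‖embHdiv Ω τ‖ * ‖v.1.2‖ := by
            gcongr
            · exact (norm_restrictL2_le hK _).trans n2
            · exact (norm_restrictL2_le hK _).trans n1
        _ = _ := by ring
    rw [h, mul_zero] at hle
    exact abs_nonpos_iff.1 hle
  refine Subtype.ext (funext fun K => ?_)
  refine ContinuousLinearMap.ext (M₁ := HHalf K.1) fun t => ?_
  obtain ⟨v, rfl⟩ := Submodule.mkQ_surjective _ t
  exact key K v

/-! ### The forms as bilinear maps -/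

theorem formA_eq (mu : ℝ) (v u : X T) :
    formA mu v u = 2 * mu * inner ℝ (strainL2 T u) (strainL2 T v) := by
  rw [← real_inner_smul_left]
  refine T.sum_setIntegral_eq_inner _ _ ?_
  filter_upwards [strainL2_ae u, strainL2_ae v, Lp.coeFn_smul (2 * mu) (strainL2 T u)]
    with x h1 h2 h3
  rw [h1, h2, h3, Pi.smul_apply]

theorem formC_eq (v : X T) (q : P Γ) : formC v q = inner ℝ (divL2 T v) q.1 := by
  refine T.sum_setIntegral_eq_inner _ _ ?_
  filter_upwards [divL2_ae v] with x h1
  rw [h1, mul_comm]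
  rfl

theorem ipP_eq (q q' : P Γ) : ipP q q' = inner ℝ q.1 q'.1 := by
  rw [L2.inner_def]
  refine integral_congr_ae (Eventually.of_forall fun x => ?_)
  exact mul_comm _ _

theorem formAA_eq (mu lam : ℝ) (x y : H Γ T) :
    formAA mu lam x y = 2 * mu * inner ℝ (strainL2 T x.1) (strainL2 T y.1) +
      inner ℝ (divL2 T y.1) x.2.1 - inner ℝ (divL2 T x.1) y.2.1 +
      1 / lam * inner ℝ x.2.1 y.2.1 := by
  rw [formAA, formA_eq, formC_eq, formC_eq, ipP_eq, real_inner_comm]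

/-- `𝔞` as a bilinear map. -/
noncomputable def bilinA (Γ : BoundaryPartition Ω) (T : Mesh Ω) (mu lam : ℝ) :
    H Γ T →ₗ[ℝ] H Γ T →ₗ[ℝ] ℝ :=
  LinearMap.mk₂ ℝ (formAA mu lam)
    (fun x x' y => by
      simp only [formAA_eq, Prod.fst_add, Prod.snd_add, map_add, Submodule.coe_add,
        inner_add_left, inner_add_right]
      ring)
    (fun c x y => by
      simp only [formAA_eq, Prod.smul_fst, Prod.smul_snd, map_smul, Submodule.coe_smul,
        real_inner_smul_left, real_inner_smul_right, smul_eq_mul]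
      ring)
    (fun x y y' => by
      simp only [formAA_eq, Prod.fst_add, Prod.snd_add, map_add, Submodule.coe_add,
        inner_add_left, inner_add_right]
      ring)
    (fun c x y => by
      simp only [formAA_eq, Prod.smul_fst, Prod.smul_snd, map_smul, Submodule.coe_smul,
        real_inner_smul_left, real_inner_smul_right, smul_eq_mul]
      ring)

theorem HMinusHalf.integral_add {D : Set (Vec d)} (l : HMinusHalf D) (v w : H1 D) :
    l.integral (v + w) = l.integral v + l.integral w := by
  simp only [integral, map_add]
  exact map_add (show StrongDual ℝ (HHalf D) from l) _ _

theorem HMinusHalf.integral_smul {D : Set (Vec d)} (l : HMinusHalf D) (c : ℝ) (v : H1 D) :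
    l.integral (c • v) = c * l.integral v := by
  simp only [integral, map_smul]
  exact map_smul (show StrongDual ℝ (HHalf D) from l) _ _

theorem HMinusHalf.add_integral {D : Set (Vec d)} (l l' : HMinusHalf D) (v : H1 D) :
    (l + l').integral v = l.integral v + l'.integral v := rfl

theorem HMinusHalf.smul_integral {D : Set (Vec d)} (c : ℝ) (l : HMinusHalf D) (v : H1 D) :
    (c • l).integral v = c * l.integral v := rfl

/-- The sum of the boundary integrals over the elements, as a bilinear map. -/
noncomputable def boundaryPairing (Γ : BoundaryPartition Ω) (T : Mesh Ω) :
    X T →ₗ[ℝ] M Γ T →ₗ[ℝ] ℝ :=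
  LinearMap.mk₂ ℝ (fun v l => ∑ K : T.Cell, (l.1 K).integral (X.toCell K v))
    (fun v w l => by simp only [map_add, HMinusHalf.integral_add, Finset.sum_add_distrib])
    (fun c v l => by
      simp only [map_smul, HMinusHalf.integral_smul, Finset.mul_sum, smul_eq_mul])
    (fun v l l' => by
      simp only [Submodule.coe_add, Pi.add_apply, HMinusHalf.add_integral,
        Finset.sum_add_distrib])
    (fun c v l => by
      simp only [Submodule.coe_smul, Pi.smul_apply, HMinusHalf.smul_integral, Finset.mul_sum,
        smul_eq_mul])

/-- `𝔟` as a bilinear map. -/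
noncomputable def bilinB (Γ : BoundaryPartition Ω) (T : Mesh Ω) : H Γ T →ₗ[ℝ] M Γ T →ₗ[ℝ] ℝ :=
  -(boundaryPairing Γ T ∘ₗ LinearMap.fst ℝ _ _)

/-- The load as a linear functional of the whole pair `(v, q)`. -/
noncomputable def loadMap (dat : ProblemData Γ T) : H Γ T →ₗ[ℝ] ℝ where
  toFun y := dat.load y.1
  map_add' y y' := by
    have h : ∀ v : X T, ∫ x in Ω.carrier, inner ℝ (dat.f x) (X.val v x) = inner ℝ dat.f v.1.1 :=
      fun v => (L2.inner_def _ _).symm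
    simp only [ProblemData.load, h, Prod.fst_add, Submodule.coe_add, inner_add_right, map_add,
      HMinusHalf.integral_add, Finset.sum_add_distrib]
    ring
  map_smul' c y := by
    have h : ∀ v : X T, ∫ x in Ω.carrier, inner ℝ (dat.f x) (X.val v x) = inner ℝ dat.f v.1.1 :=
      fun v => (L2.inner_def _ _).symm
    simp only [ProblemData.load, h, Prod.smul_fst, Submodule.coe_smul, real_inner_smul_right,
      map_smul, HMinusHalf.integral_smul, ← Finset.mul_sum, smul_eq_mul, RingHom.id_apply]
    ring

/-- `l ↦ -⟨l, u_D⟩` as a linear functional. -/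
noncomputable def dirichletMap (dat : ProblemData Γ T) : M Γ T →ₗ[ℝ] ℝ :=
  -boundaryPairing Γ T (H1.toX T dat.uD)

/-! ### Continuity of the forms -/

theorem isContinuityConstA (dat : ProblemData Γ T) :
    IsContinuityConstA Γ T dat.mu dat.lam
      (2 * dat.mu + 2 * ‖tensTrace d‖ + 1 / dat.lam) := by
  intro x y
  have hmu := dat.mu_pos
  have hlam := dat.lam_pos
  rw [← seminormH_apply, ← seminormH_apply, formAA_eq]
  have sx := (norm_strainL2_le x.1).trans (normX_le x)
  have sy := (norm_strainL2_le y.1).trans (normX_le y)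
  have qx := norm_pressure_le x
  have qy := norm_pressure_le y
  have bound : ∀ {F : Type} [NormedAddCommGroup F] [InnerProductSpace ℝ F] (f g : F) {a b : ℝ},
      0 ≤ a → ‖f‖ ≤ a → ‖g‖ ≤ b → |inner ℝ f g| ≤ a * b := fun f g a b ha hf hg =>
    (abs_real_inner_le_norm f g).trans (mul_le_mul hf hg (norm_nonneg _) ha)
  set X₁ := seminormH Γ T x
  set Y₁ := seminormH Γ T y
  have hX : 0 ≤ X₁ := apply_nonneg _ _
  have hY : 0 ≤ Y₁ := apply_nonneg _ _
  have dx : ‖divL2 T x.1‖ ≤ ‖tensTrace d‖ * X₁ := (norm_divL2_le x.1).trans (by gcongr)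
  have dy : ‖divL2 T y.1‖ ≤ ‖tensTrace d‖ * Y₁ := (norm_divL2_le y.1).trans (by gcongr)
  have b1 := bound _ _ hX sx sy
  have b2 := bound _ _ (by positivity) dy qx
  have b3 := bound _ _ (by positivity) dx qy
  have b4 := bound _ _ hX qx qy
  calc _ ≤ |2 * dat.mu * inner ℝ (strainL2 T x.1) (strainL2 T y.1)| +
        |inner ℝ (divL2 T y.1) x.2.1| + |inner ℝ (divL2 T x.1) y.2.1| +
        |1 / dat.lam * inner ℝ x.2.1 y.2.1| :=
        (abs_add_le _ _).trans (add_le_add_left ((abs_sub _ _).trans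
          (add_le_add_left (abs_add_le _ _) _)) _)
    _ ≤ 2 * dat.mu * (X₁ * Y₁) + ‖tensTrace d‖ * Y₁ * X₁ + ‖tensTrace d‖ * X₁ * Y₁ +
        1 / dat.lam * (X₁ * Y₁) := by
        rw [abs_mul, abs_mul (1 / dat.lam), abs_of_pos (by positivity : 0 < 2 * dat.mu),
          abs_of_pos (by positivity : 0 < 1 / dat.lam)]
        gcongr
    _ = _ := by ring

/-- Green's formula on each element, summed; only the symmetric part of `∇v` is seen by the
symmetric field `τ`. -/
theorem formB_eq (hd : 0 < d) (v : X T) {l : M Γ T}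
    {τ : L2 Ω.carrier (Tens d) × L2 Ω.carrier (Vec d)} (hτ : τ ∈ liftings Γ T l) :
    formB v l = -inner ℝ (embHdiv Ω τ) (embX T v) := by
  have h1 : ∀ K : T.Cell, (l.1 K).integral (X.toCell K v) =
      (∫ x in K.1, inner ℝ (τ.1 x) (v.1.2 x)) + ∫ x in K.1, inner ℝ (τ.2 x) (v.1.1 x) := by
    intro K
    have hK := T.subset K K.2
    have e : ∀ {F : Type} [NormedAddCommGroup F] [InnerProductSpace ℝ F] (f g : L2 Ω.carrier F),
        inner ℝ (restrictL2 hK f) (restrictL2 hK g) = ∫ x in K.1, inner ℝ (f x) (g x) := by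
      intro F _ _ f g
      rw [L2.inner_def]
      refine integral_congr_ae ?_
      filter_upwards [restrictL2_ae hK f, restrictL2_ae hK g] with x h1 h2
      rw [h1, h2]
    rw [hτ.2 K, green_eq hK, add_comm, ← e, ← e]
    rfl
  have hsym := hτ.1.1.2
  rw [formB, Finset.sum_congr rfl fun K _ => h1 K, Finset.sum_add_distrib, inner_embHdiv_embX hd,
    T.sum_setIntegral_eq_inner τ.2 v.1.1 EventuallyEq.rfl,
    T.sum_setIntegral_eq_inner τ.1 (strainL2 T v)]
  filter_upwards [hsym, (symPart d).coeFn_compLpL (p := 2) v.1.2] with x h1 h2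
  have h3 : strainL2 T v x = symPart d (v.1.2 x) := h2
  rw [h3, inner_symPart h1]

theorem isContinuityConstB (hd : 0 < d) (Γ : BoundaryPartition Ω) (T : Mesh Ω) :
    IsContinuityConstB Γ T 1 := by
  intro y l
  rw [one_mul, ← seminormH_apply]
  refine le_mul_normM (apply_nonneg _ _) fun τ hτ => ?_
  rw [formBB, formB_eq hd y.1 hτ, abs_neg, mul_comm]
  refine (abs_real_inner_le_norm _ _).trans ?_
  gcongr
  rw [← normX_eq]
  exact normX_le y

/-! ### The discrete problem as an abstract saddle-point problem -/

theorem kernelHDP_eq_prod (Xh : Submodule ℝ (X T)) (Ph : Submodule ℝ (P Γ))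
    (Mh : Submodule ℝ (M Γ T)) :
    kernelHDP Xh Ph Mh = kernelB Xh Mh ×ˢ (Ph : Set (P Γ)) := by
  ext ⟨v, q⟩
  simp only [kernelHDP, kernelB, mem_ofPred_eq, mem_prod, Submodule.mem_prod, formBB,
    SetLike.mem_coe]
  tauto

/-- Testing with `(v, 0)` and `(0, q)` separates the equations of the saddle-point form. -/
theorem isSaddleSolution_iff (dat : ProblemData Γ T) (Xh : Submodule ℝ (X T))
    (Ph : Submodule ℝ (P Γ)) (Mh : Submodule ℝ (M Γ T)) (s : H Γ T × M Γ T) :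
    IsSaddleSolution dat Xh Ph Mh s ↔ IsSolution dat Xh Ph Mh s := by
  have eA : ∀ v : X T, formA dat.mu s.1.1 v = formA dat.mu v s.1.1 := fun v => by
    rw [formA_eq, formA_eq, real_inner_comm]
  have load0 : dat.load 0 = 0 := map_zero (loadMap dat)
  constructor
  · rintro ⟨⟨h1, h2⟩, h3, h4⟩
    refine ⟨⟨h1.1, h1.2, h2⟩, fun v hv => ?_, h4, fun q hq => ?_⟩
    · have := h3 (v, 0) ⟨hv, zero_mem _⟩
      rw [formAA, formBB, eA] at this
      simp only [formC_eq, ipP_eq, Submodule.coe_zero, inner_zero_right] at this ⊢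
      linarith
    · have := h3 (0, q) ⟨zero_mem _, hq⟩
      have hb : formB 0 s.2 = 0 := by
        have : bilinB Γ T 0 s.2 = 0 := by simp
        exact this
      rw [formAA, formBB, hb, load0] at this
      simp only [formA_eq, formC_eq, ipP_eq, map_zero, inner_zero_left, mul_zero] at this ⊢
      linarith
  · rintro ⟨⟨h1, h2, h3⟩, h4, h5, h6⟩
    refine ⟨⟨⟨h1, h2⟩, h3⟩, fun y hy => ?_, h5⟩
    have e1 := h4 y.1 hy.1
    have e2 := h6 y.2 hy.2
    rw [formAA, formBB, eA]
    linarith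

theorem isSaddleSolution_iff_solvesSaddle (dat : ProblemData Γ T) (Xh : Submodule ℝ (X T))
    (Ph : Submodule ℝ (P Γ)) (Mh : Submodule ℝ (M Γ T)) (s : H Γ T × M Γ T) :
    IsSaddleSolution dat Xh Ph Mh s ↔
      SolvesSaddle (bilinA Γ T dat.mu dat.lam) (bilinB Γ T) (Xh.prod Ph) Mh (loadMap dat)
        (dirichletMap dat) s := Iff.rfl

theorem ConditionB1.infSupA {dat : ProblemData Γ T} {Xh : Submodule ℝ (X T)}
    {Ph : Submodule ℝ (P Γ)} {Mh : Submodule ℝ (M Γ T)} {α : ℝ}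
    (h : ConditionB1 dat Xh Ph Mh α) :
    InfSupA (seminormH Γ T) (bilinA Γ T dat.mu dat.lam)
      (saddleKernel (bilinB Γ T) (Xh.prod Ph) Mh) α := by
  intro x hx
  simp only [seminormH_apply]
  exact h x hx

theorem ConditionB2.infSupB {Xh : Submodule ℝ (X T)} {Ph : Submodule ℝ (P Γ)}
    {Mh : Submodule ℝ (M Γ T)} {β : ℝ} (h : ConditionB2 Xh Ph Mh β) :
    InfSupB (seminormH Γ T) (seminormM Γ T) (bilinB Γ T) (Xh.prod Ph) Mh β := by
  intro l hl
  simp only [seminormH_apply]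
  exact h l hl

theorem finiteDimensional_prod {E F : Type*} [AddCommGroup E] [Module ℝ E] [AddCommGroup F]
    [Module ℝ F] (V : Submodule ℝ E) (W : Submodule ℝ F) [FiniteDimensional ℝ V]
    [FiniteDimensional ℝ W] : FiniteDimensional ℝ (V.prod W) :=
  Module.Finite.iff_fg.2 ((Module.Finite.iff_fg.1 ‹_›).prod (Module.Finite.iff_fg.1 ‹_›))

theorem le_mul_iInf_add_mul_iInf {ι κ : Type*} [Nonempty ι] [Nonempty κ] {f : ι → ℝ} {g : κ → ℝ}
    {a b c : ℝ} (ha : 0 ≤ a) (hb : 0 ≤ b) (h : ∀ i j, c ≤ a * f i + b * g j) :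
    c ≤ a * (⨅ i, f i) + b * ⨅ j, g j := by
  rw [Real.mul_iInf_of_nonneg ha, Real.mul_iInf_of_nonneg hb]
  exact le_ciInf_add_ciInf h

end HDP

theorem mainTheorem7 :
    ∃ C₁ C₂ C₃ C₄ : ℝ → ℝ → ℝ → ℝ → ℝ,
      ∀ (d : ℕ) (_ : d = 2 ∨ d = 3) (Ω : HDP.PolyhedralDomain d) (Γ : HDP.BoundaryPartition Ω)
        (T : HDP.Mesh Ω) (dat : HDP.ProblemData Γ T)
        (Xh : Submodule ℝ (HDP.X T)) (Ph : Submodule ℝ (HDP.P Γ)) (Mh : Submodule ℝ (HDP.M Γ T))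
        (_ : FiniteDimensional ℝ Xh) (_ : FiniteDimensional ℝ Ph) (_ : FiniteDimensional ℝ Mh),
        (∃ Ca, HDP.IsContinuityConstA Γ T dat.mu dat.lam Ca) ∧
        (∃ Cb, HDP.IsContinuityConstB Γ T Cb) ∧
        HDP.kernelHDP Xh Ph Mh = HDP.kernelB Xh Mh ×ˢ (Ph : Set (HDP.P Γ)) ∧
        (∀ s, HDP.IsSaddleSolution dat Xh Ph Mh s ↔ HDP.IsSolution dat Xh Ph Mh s) ∧
        ∀ α β : ℝ, 0 < α → 0 < β →
          HDP.ConditionB1 dat Xh Ph Mh α → HDP.ConditionB2 Xh Ph Mh β →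
          (∃! s, HDP.IsSaddleSolution dat Xh Ph Mh s) ∧
          (∃! s, HDP.IsSolution dat Xh Ph Mh s) ∧
          ∀ Ca Cb : ℝ,
            HDP.IsContinuityConstA Γ T dat.mu dat.lam Ca → HDP.IsContinuityConstB Γ T Cb →
            ∀ s sh : HDP.H Γ T × HDP.M Γ T,
              HDP.IsExactSolution dat s → HDP.IsSaddleSolution dat Xh Ph Mh sh →
              HDP.normH (s.1 - sh.1) ≤
                  C₁ α β Ca Cb * (⨅ y : Xh.prod Ph, HDP.normH (s.1 - y.1)) +
                  C₂ α β Ca Cb * (⨅ l : Mh, HDP.normM (s.2 - l.1)) ∧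
              HDP.normM (s.2 - sh.2) ≤
                  C₃ α β Ca Cb * (⨅ y : Xh.prod Ph, HDP.normH (s.1 - y.1)) +
                  C₄ α β Ca Cb * (⨅ l : Mh, HDP.normM (s.2 - l.1)) := by
  -- The absolute value of a continuity constant is again one, and it has the sign that the
  -- estimates need.
  refine ⟨fun α β Ca Cb => (1 + |Ca| / α) * (1 + |Cb| / β), fun α β Ca Cb => |Cb| / α,
    fun α β Ca Cb => |Ca| / β * ((1 + |Ca| / α) * (1 + |Cb| / β)),
    fun α β Ca Cb => |Ca| / β * (|Cb| / α) + (1 + |Cb| / β), ?_⟩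
  intro d hd' Ω Γ T dat Xh Ph Mh _ _ _
  have hd : 0 < d := by omega
  refine ⟨⟨_, HDP.isContinuityConstA dat⟩, ⟨1, HDP.isContinuityConstB hd Γ T⟩,
    HDP.kernelHDP_eq_prod Xh Ph Mh, HDP.isSaddleSolution_iff dat Xh Ph Mh, ?_⟩
  intro α β hα hβ hB1 hB2
  have : FiniteDimensional ℝ (Xh.prod Ph) := HDP.finiteDimensional_prod Xh Ph
  have h1 := hB1.infSupA
  have h2 := hB2.infSupB
  have hex : ∃! s, HDP.IsSaddleSolution dat Xh Ph Mh s :=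
    HDP.existsUnique_saddle (fun x => HDP.eq_zero_of_seminormH_eq_zero hd)
      (fun l => HDP.eq_zero_of_normM_eq_zero hd) hα hβ h1 h2 (HDP.loadMap dat)
      (HDP.dirichletMap dat)
  refine ⟨hex, ?_, ?_⟩
  · simpa only [HDP.isSaddleSolution_iff] using hex
  intro Ca Cb hCa hCb s sh hs hsh
  have hA : ∀ x y, |HDP.bilinA Γ T dat.mu dat.lam x y| ≤
      |Ca| * HDP.seminormH Γ T x * HDP.seminormH Γ T y := fun x y => by
    refine (hCa x y).trans ?_
    rw [← HDP.seminormH_apply, ← HDP.seminormH_apply]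
    gcongr
    exact le_abs_self _
  have hB : ∀ y l, |HDP.bilinB Γ T y l| ≤
      |Cb| * HDP.seminormH Γ T y * HDP.seminormM Γ T l := fun y l => by
    refine (hCb y l).trans ?_
    rw [← HDP.seminormH_apply, ← HDP.seminormM_apply]
    gcongr
    exact le_abs_self _
  -- The exact solution satisfies the discrete equations, since the discrete spaces are subspaces.
  have hs' := (HDP.isSaddleSolution_iff dat ⊤ ⊤ ⊤ s).2 hs
  rw [HDP.isSaddleSolution_iff_solvesSaddle] at hs' hsh
  have o1 : ∀ y ∈ Xh.prod Ph, HDP.bilinA Γ T dat.mu dat.lam (s.1 - sh.1) y +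
      HDP.bilinB Γ T y (s.2 - sh.2) = 0 := fun y hy => by
    have e1 := hs'.2.1 y ⟨trivial, trivial⟩
    have e2 := hsh.2.1 y hy
    simp only [map_sub, LinearMap.sub_apply]
    linarith
  have o2 : ∀ l ∈ Mh, HDP.bilinB Γ T (s.1 - sh.1) l = 0 := fun l hl => by
    have e1 := hs'.2.2 l trivial
    have e2 := hsh.2.2 l hl
    simp only [map_sub, LinearMap.sub_apply]
    linarith
  have key : ∀ (y : Xh.prod Ph) (l : Mh), HDP.normH (s.1 - sh.1) ≤
      (1 + |Ca| / α) * (1 + |Cb| / β) * HDP.normH (s.1 - y.1) +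
        |Cb| / α * HDP.normM (s.2 - l.1) := fun y l => by
    have := HDP.saddle_error_le hα hβ h1 h2 (abs_nonneg Ca) (abs_nonneg Cb) hA hB hsh.1.1
      hsh.1.2 o1 o2 y.2 l.2
    rwa [HDP.seminormH_apply, HDP.seminormH_apply] at this
  have hpos : 0 ≤ |Ca| / β := by positivity
  refine ⟨HDP.le_mul_iInf_add_mul_iInf (by positivity) (by positivity) key,
    HDP.le_mul_iInf_add_mul_iInf (by positivity) (by positivity) fun y l => ?_⟩
  have hm := HDP.saddle_multiplier_error_le hβ h2 (abs_nonneg Ca) (abs_nonneg Cb) hA hB hsh.1.2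
    o1 l.2
  rw [HDP.seminormH_apply, HDP.seminormM_apply, HDP.seminormM_apply] at hm
  have hk := mul_le_mul_of_nonneg_left (key y l) hpos
  linarith
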